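/- Let $H$ be a complex Hilbert space. An R$^*$-algebra is a $^*$-subalgebra $A$ of $B(H)$ (not necessarily unital or closed) that is von Neumann regular: for every $x\in A$ there is $y\in A$ with $xyx=x$. Let $\mathcal P(A)=\{p\in A\mid p=p^2=p^*\}$, ordered by $p\le q$ iff $pq=p$. A lattice is called upward $\sigma$-complete if every nonempty countable family has a least upper bound, and $\sigma$-complete if every nonempty countable family has both a least upper bound and a greatest lower bound. For a generalized Boolean algebra $\mathcal S$, represented as a generalized field of subsets of a set $X$ (a nonempty family closed under $\cup$, $\cap$ and $\setminus$), $R(\mathcal S)$ is the commutative R$^*$-algebra of all functions $f\colon X\to\mathbb C$ with finite range such that $f^{-1}(z)\in\mathcal S$ for every $z\in\mathbb C\setminus\{0\}$; up to $^*$-isomorphism it does not depend on the representation. For an R$^*$-algebra $A$ the following conditions are equivalent: 1. $\mathcal P(A)$ is $\sigma$-complete. 2. $\mathcal P(A)$ is upward $\sigma$-complete. 3. There exist a $\sigma$-complete generalized Boolean algebra $\mathcal S$ and a finite-dimensional R$^*$-algebra $B$ such that $A$ is $^*$-isomorphic to $R(\mathcal S)\oplus B$. Moreover, $A$ is a Baer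 ring (that is, for every subset $X\subset A$ there is an idempotent $e\in A$ with $\{r\in A\mid xr=0 \text{ for all } x\in X\}=eA$) if and only if there exist a complete Boolean algebra $\mathcal S$ and a finite-dimensional R$^*$-algebra $B$ such that $A$ is $^*$-isomorphic to $R(\mathcal S)\oplus B$. -/

import Mathlib

universe u

/-- A `*`-subalgebra `A` of `B(H)` (not necessarily unital, not necessarily closed) is an
R*-algebra if it is regular in the sense of von Neumann. -/
def IsRStarAlgebra {H : Type*} [NormedAddCommGroup H] [InnerProductSpace ℂ H] [CompleteSpace H]
    (A : NonUnitalStarSubalgebra ℂ (H →L[ℂ] H)) : Prop :=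
  ∀ x ∈ A, ∃ y ∈ A, x * y * x = x

/-- The set `P(A)` of projections `p = p² = p*` of a `*`-algebra `A`. -/
def ProjectionLattice (A : Type*) [NonUnitalRing A] [StarRing A] : Type _ :=
  {p : A // IsStarProjection p}

/-- The usual order of projections: `p ≤ q` means `p q = p`. -/
instance ProjectionLattice.instPartialOrder (A : Type*) [NonUnitalRing A] [StarRing A] :
    PartialOrder (ProjectionLattice A) where
  le p q := p.1 * q.1 = p.1
  le_refl p := p.2.isIdempotentElem
  le_trans p q r hpq hqr := by
    change p.1 * q.1 = p.1 at hpq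
    change q.1 * r.1 = q.1 at hqr
    rw [← hpq, mul_assoc, hqr]
  le_antisymm p q hpq hqp := by
    change p.1 * q.1 = p.1 at hpq
    change q.1 * p.1 = q.1 at hqp
    apply Subtype.ext
    have h := congrArg star hpq
    rw [star_mul, p.2.isSelfAdjoint.star_eq, q.2.isSelfAdjoint.star_eq] at h
    exact h.symm.trans hqp

/-- Every nonempty countable family has a least upper bound. -/
def IsUpwardSigmaComplete (P : Type*) [PartialOrder P] : Prop :=
  ∀ s : Set P, s.Nonempty → s.Countable → ∃ b, IsLUB s b

/-- Every nonempty countable family has a greatest lower bound. -/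
def IsDownwardSigmaComplete (P : Type*) [PartialOrder P] : Prop :=
  ∀ s : Set P, s.Nonempty → s.Countable → ∃ b, IsGLB s b

/-- Every nonempty countable family has a least upper bound and a greatest lower bound. -/
def IsSigmaComplete (P : Type*) [PartialOrder P] : Prop :=
  IsUpwardSigmaComplete P ∧ IsDownwardSigmaComplete P

/-- A ring (possibly without unit) is Baer if the right annihilator of every subset is of the
form `eR` for an idempotent `e`. -/
def IsBaerRing (R : Type*) [NonUnitalRing R] : Prop :=
  ∀ X : Set R, ∃ e : R, IsIdempotentElem e ∧
    {r : R | ∀ x ∈ X, x * r = 0} = Set.range (fun r : R => e * r)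

/-- A generalized field of sets on `X`: a nonempty family of subsets of `X` closed under binary
unions, binary intersections and differences. -/
structure GeneralizedSetField (X : Type*) where
  sets : Set (Set X)
  nonempty' : sets.Nonempty
  union_mem' : ∀ {s t : Set X}, s ∈ sets → t ∈ sets → s ∪ t ∈ sets
  inter_mem' : ∀ {s t : Set X}, s ∈ sets → t ∈ sets → s ∩ t ∈ sets
  diff_mem' : ∀ {s t : Set X}, s ∈ sets → t ∈ sets → s \ t ∈ sets

namespace GeneralizedSetField

variable {X : Type*} (F : GeneralizedSetField X)

theorem empty_mem : (∅ : Set X) ∈ F.sets := by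
  obtain ⟨s, hs⟩ := F.nonempty'
  simpa using F.diff_mem' hs hs

theorem biUnion_mem {ι : Type*} {I : Set ι} (hI : I.Finite) (f : ι → Set X)
    (hf : ∀ i ∈ I, f i ∈ F.sets) : (⋃ i ∈ I, f i) ∈ F.sets := by
  induction I, hI using Set.Finite.induction_on with
  | empty => simpa using F.empty_mem
  | @insert a s _ _ ih =>
    rw [Set.biUnion_insert]
    exact F.union_mem' (hf a (Set.mem_insert a s))
      (ih fun i hi => hf i (Set.mem_insert_of_mem a hi))

/-- `f` takes finitely many values and `f⁻¹(z)` belongs to the field for every `z ≠ 0`. -/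
def IsSimple (f : X → ℂ) : Prop :=
  (Set.range f).Finite ∧ ∀ z : ℂ, z ≠ 0 → f ⁻¹' {z} ∈ F.sets

variable {F}

theorem IsSimple.support_mem {f : X → ℂ} (hf : F.IsSimple f) : {x | f x ≠ 0} ∈ F.sets := by
  have h : {x | f x ≠ 0} = ⋃ z ∈ Set.range f \ {0}, f ⁻¹' {z} := by
    ext x
    simp
  rw [h]
  exact F.biUnion_mem (hf.1.subset Set.sdiff_subset) _ fun z hz => hf.2 z hz.2

theorem IsSimple.inter_mem {f g : X → ℂ} (hf : F.IsSimple f) (hg : F.IsSimple g) {a b : ℂ}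
    (hab : a ≠ 0 ∨ b ≠ 0) : f ⁻¹' {a} ∩ g ⁻¹' {b} ∈ F.sets := by
  by_cases ha : a = 0
  · have hb : b ≠ 0 := hab.resolve_left (not_not.2 ha)
    have h : f ⁻¹' {a} ∩ g ⁻¹' {b} = g ⁻¹' {b} \ {x | f x ≠ 0} := by
      ext x
      simp [ha, and_comm]
    rw [h]
    exact F.diff_mem' (hg.2 b hb) hf.support_mem
  · by_cases hb : b = 0
    · have h : f ⁻¹' {a} ∩ g ⁻¹' {b} = f ⁻¹' {a} \ {x | g x ≠ 0} := by
        ext x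
        simp [hb]
      rw [h]
      exact F.diff_mem' (hf.2 a ha) hg.support_mem
    · exact F.inter_mem' (hf.2 a ha) (hg.2 b hb)

theorem IsSimple.map₂ {f g : X → ℂ} (hf : F.IsSimple f) (hg : F.IsSimple g) (φ : ℂ → ℂ → ℂ)
    (hφ : φ 0 0 = 0) : F.IsSimple (fun x => φ (f x) (g x)) := by
  have hfin : (Set.range f ×ˢ Set.range g).Finite := hf.1.prod hg.1
  refine ⟨(hfin.image fun p : ℂ × ℂ => φ p.1 p.2).subset ?_, fun z hz => ?_⟩
  · rintro _ ⟨x, rfl⟩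
    exact ⟨(f x, g x), ⟨⟨x, rfl⟩, ⟨x, rfl⟩⟩, rfl⟩
  · have h : (fun x => φ (f x) (g x)) ⁻¹' {z} =
        ⋃ p ∈ {p ∈ Set.range f ×ˢ Set.range g | φ p.1 p.2 = z},
          f ⁻¹' {p.1} ∩ g ⁻¹' {p.2} := by
      ext x
      simp only [Set.mem_preimage, Set.mem_singleton_iff, Set.mem_iUnion, Set.mem_inter_iff,
        exists_prop]
      constructor
      · intro hx
        exact ⟨(f x, g x), ⟨⟨⟨x, rfl⟩, ⟨x, rfl⟩⟩, hx⟩, rfl, rfl⟩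
      · rintro ⟨p, hp, h1, h2⟩
        rw [h1, h2]
        exact hp.2
    rw [h]
    refine F.biUnion_mem (hfin.subset fun p hp => hp.1) _ fun p hp => hf.inter_mem hg ?_
    by_contra hcon
    push Not at hcon
    apply hz
    rw [← hp.2, hcon.1, hcon.2, hφ]

variable (F)

theorem isSimple_zero : F.IsSimple (fun _ => 0) := by
  refine ⟨(Set.finite_singleton (0 : ℂ)).subset ?_, fun z hz => ?_⟩
  · rintro _ ⟨x, rfl⟩
    rfl
  · have h : (fun _ : X => (0 : ℂ)) ⁻¹' {z} = ∅ := by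
      ext x
      simpa using hz.symm
    rw [h]
    exact F.empty_mem

/-- The commutative R*-algebra `R(F)` of functions `f : X → ℂ` with finitely many values such
that `f⁻¹(z)` belongs to `F` for every `z ≠ 0`, with pointwise operations. -/
def functionAlgebra : NonUnitalStarSubalgebra ℂ (X → ℂ) where
  carrier := {f | F.IsSimple f}
  add_mem' hf hg := hf.map₂ hg (fun a b => a + b) (add_zero 0)
  zero_mem' := F.isSimple_zero
  mul_mem' hf hg := hf.map₂ hg (fun a b => a * b) (mul_zero 0)
  smul_mem' c _ hf := hf.map₂ hf (fun a _ => c * a) (mul_zero c)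
  star_mem' hf := hf.map₂ hf (fun a _ => star a) (star_zero ℂ)

end GeneralizedSetField

/-- The points of the Stone space of `S`: the prime ideals of `S`. -/
def StonePoint (S : Type*) [GeneralizedBooleanAlgebra S] : Type _ :=
  {I : Order.Ideal S // I.IsPrime}

/-- The compact open subset of the Stone space that belongs to `a`. -/
def stoneSet {S : Type*} [GeneralizedBooleanAlgebra S] (a : S) : Set (StonePoint S) :=
  {I | a ∉ I.1}

section Stone

variable {S : Type*} [GeneralizedBooleanAlgebra S]

theorem stoneSet_sup (a b : S) : stoneSet (a ⊔ b) = stoneSet a ∪ stoneSet b := by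
  ext I
  simp only [stoneSet, Set.mem_ofPred_eq, Set.mem_union, Order.Ideal.sup_mem_iff]
  tauto

theorem stoneSet_inf (a b : S) : stoneSet (a ⊓ b) = stoneSet a ∩ stoneSet b := by
  ext I
  simp only [stoneSet, Set.mem_ofPred_eq, Set.mem_inter_iff]
  constructor
  · intro h
    exact ⟨fun ha => h (I.1.lower inf_le_left ha), fun hb => h (I.1.lower inf_le_right hb)⟩
  · rintro ⟨ha, hb⟩ h
    exact (I.2.mem_or_mem h).elim ha hb

theorem stoneSet_bot : stoneSet (⊥ : S) = ∅ := by
  ext I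
  simp [stoneSet]

theorem stoneSet_sdiff (a b : S) : stoneSet (a \ b) = stoneSet a \ stoneSet b := by
  have h1 : stoneSet (a \ b) ∪ stoneSet (a ⊓ b) = stoneSet a := by
    rw [← stoneSet_sup, sup_comm, sup_inf_sdiff]
  have h2 : stoneSet (a \ b) ∩ stoneSet b = ∅ := by
    rw [← stoneSet_inf, inf_comm, inf_sdiff_self_right, stoneSet_bot]
  rw [stoneSet_inf] at h1
  ext I
  have h1' := Set.ext_iff.1 h1 I
  have h2' := Set.ext_iff.1 h2 I
  simp only [Set.mem_union, Set.mem_inter_iff, Set.mem_empty_iff_false, Set.mem_sdiff] at *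
  tauto

/-- Stone's representation is faithful: `S` is isomorphic, as a lattice, to the generalized field
of the sets `stoneSet a`. -/
theorem stoneSet_subset_iff (a b : S) : stoneSet a ⊆ stoneSet b ↔ a ≤ b := by
  constructor
  · intro h
    by_contra hab
    have hd : Disjoint (Order.PFilter.principal a : Set S) (Order.Ideal.principal b : Set S) := by
      rw [Set.disjoint_left]
      intro x hx hx'
      exact hab (le_trans hx hx')
    obtain ⟨J, hJ, hbJ, haJ⟩ := DistribLattice.prime_ideal_of_disjoint_filter_ideal hd
    have ha : a ∉ J := Set.disjoint_left.1 haJ (le_refl a)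
    have hb : b ∈ J := hbJ (le_refl b)
    exact h (show (⟨J, hJ⟩ : StonePoint S) ∈ stoneSet a from ha) hb
  · intro hab I ha hb
    exact ha (I.1.lower hab hb)

end Stone

/-- The generalized field of sets on the Stone space of `S` that represents `S`. -/
def stoneField (S : Type*) [GeneralizedBooleanAlgebra S] : GeneralizedSetField (StonePoint S) where
  sets := Set.range stoneSet
  nonempty' := ⟨_, ⟨⊥, rfl⟩⟩
  union_mem' := by
    rintro _ _ ⟨a, rfl⟩ ⟨b, rfl⟩
    exact ⟨a ⊔ b, stoneSet_sup a b⟩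
  inter_mem' := by
    rintro _ _ ⟨a, rfl⟩ ⟨b, rfl⟩
    exact ⟨a ⊓ b, stoneSet_inf a b⟩
  diff_mem' := by
    rintro _ _ ⟨a, rfl⟩ ⟨b, rfl⟩
    exact ⟨a \ b, stoneSet_sdiff a b⟩

/-- The commutative R*-algebra `R(S)` of a generalized Boolean algebra `S`: the algebra of simple
functions over a generalized field of sets that represents `S`. -/
abbrev commRStarAlgebra (S : Type*) [GeneralizedBooleanAlgebra S] :
    NonUnitalStarSubalgebra ℂ (StonePoint S → ℂ) :=
  (stoneField S).functionAlgebra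

/-!
Why the theorem is true. An R*-algebra `A` is used only through the properties collected in
`IsSpectralAlgebra`; the essential one is that self-adjoint elements are finite linear combinations
of orthogonal projections of `A`. Indeed all the elements `x² - a x` are regular, so `0` is isolated
in their spectra, and therefore the spectrum of a self-adjoint `x` has no accumulation point
(`IsRStarAlgebra.isSpectralAlgebra`).

Suppose that `P(A)` is upward `σ`-complete. The key is `not_orthogonal_sequence`: there is no
infinite orthogonal sequence of `2 × 2` matrix units `vₙ` in `A`. Otherwise, let `P` be the
supremum of the initial projections of the `vₙ` and `Q` the supremum of projections onto graphs
whose angles with the initial projections vary with `n`; the element `P Q P` then has infinitely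
many eigenvalues. This works because a supremum annihilates everything which the members of the
family annihilate (`isLUB_mul_eq_zero`). It follows that the initial projection of a matrix unit
dominates a minimal projection (`exists_minimal_le`), and that an orthogonal family of such minimal
projections is finite (`not_orthogonal_sequence_minimal`). The sum `e` of a maximal family is a
central projection for which `e A` is finite-dimensional and `(1 - e) A` is commutative
(`exists_central_projection`).

A commutative spectral algebra is the algebra of simple functions over its projections: a prime
ideal of projections defines a character (`exists_commutative_representation`). Conversely, the
projections of `R(S)` are a copy of `S` (`stoneOrderIso`), while a finite-dimensional R*-algebra is
a Baer ring (`isBaerRing_of_finiteDimensional`), and in a Baer ring with the above properties all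
suprema of projections exist (`exists_isLUB_of_isBaerRing`). Infima are obtained from suprema by
taking complements below a projection (`isSigmaComplete_of_upward`). The last assertion follows
from the same decomposition, because `R(S)` is a Baer ring for complete `S`
(`isBaerRing_commRStarAlgebra`), and because arbitrary suprema of projections of `A` restrict to
`(1 - e) A`.
-/

/-! ### Spectral `*`-algebras -/

/-- The algebraic properties of an R*-algebra on which the structure theory rests. The involution is
positive definite, the ring is von Neumann regular, and every self-adjoint element is a finite
linear combination of pairwise orthogonal projections of the algebra; the spectral projections are
indexed by the nonzero eigenvalues, so that no unit is needed. -/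
structure IsSpectralAlgebra (A : Type*) [NonUnitalRing A] [StarRing A] [Module ℂ A] : Prop where
  eq_zero_of_add : ∀ x y : A, star x * x + star y * y = 0 → x = 0
  regular : ∀ x : A, ∃ y, x * y * x = x
  spectral : ∀ x : A, IsSelfAdjoint x → ∃ (s : Finset ℝ) (p : ℝ → A), 0 ∉ s ∧
    (∀ c ∈ s, IsStarProjection (p c)) ∧ (∀ c ∈ s, ∀ d ∈ s, c ≠ d → p c * p d = 0) ∧
    x = ∑ c ∈ s, (c : ℂ) • p c

theorem mul_mul_eq_of_mul_eq {A : Type*} [Semigroup A] {a b c : A} (h : a * b = c) (x : A) :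
    a * (b * x) = c * x := by
  rw [← mul_assoc, h]

section Algebra

variable {A : Type*} [NonUnitalRing A] [StarRing A]

theorem IsStarProjection.mul_self {p : A} (hp : IsStarProjection p) : p * p = p :=
  hp.isIdempotentElem

theorem IsStarProjection.star_eq {p : A} (hp : IsStarProjection p) : star p = p :=
  hp.isSelfAdjoint

/-- For projections, `p q = p` and `q p = p` are equivalent. -/
theorem IsStarProjection.mul_eq_left_comm {p q : A} (hp : IsStarProjection p)
    (hq : IsStarProjection q) (h : p * q = p) : q * p = p := by
  simpa [hp.star_eq, hq.star_eq] using congrArg star h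

theorem IsStarProjection.mul_eq_zero_comm {p q : A} (hp : IsStarProjection p)
    (hq : IsStarProjection q) (h : p * q = 0) : q * p = 0 := by
  simpa [hp.star_eq, hq.star_eq] using congrArg star h

namespace ProjectionLattice

/-- The projection of `A` underlying an element of the projection lattice. -/
def val (p : ProjectionLattice A) : A := Subtype.val p

/-- A projection of `A`, as an element of the projection lattice. -/
def of (p : A) (hp : IsStarProjection p) : ProjectionLattice A := ⟨p, hp⟩

@[simp]
theorem val_of (p : A) (hp : IsStarProjection p) : (of p hp).val = p := rfl

theorem isProj (p : ProjectionLattice A) : IsStarProjection p.val := Subtype.prop p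

theorem val_injective : Function.Injective (val : ProjectionLattice A → A) :=
  Subtype.val_injective

theorem le_iff {p q : ProjectionLattice A} : p ≤ q ↔ p.val * q.val = p.val := Iff.rfl

theorem mul_eq_right {p q : ProjectionLattice A} (h : p ≤ q) : q.val * p.val = p.val :=
  p.isProj.mul_eq_left_comm q.isProj h

theorem le_of_mul_eq_right {p q : ProjectionLattice A} (h : q.val * p.val = p.val) : p ≤ q := by
  simpa [p.isProj.star_eq, q.isProj.star_eq, le_iff] using congrArg star h

end ProjectionLattice

/-- Every element of a regular ring with positive definite involution has a range projection. -/
theorem exists_range_projection_of_regular (hpos : ∀ x : A, star x * x = 0 → x = 0)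
    (hreg : ∀ x : A, ∃ y, x * y * x = x) (x : A) :
    ∃ e w : A, IsStarProjection e ∧ e * x = x ∧ e = x * w := by
  obtain ⟨y, hy⟩ := hreg (star x * x)
  have hx : x * y * star x * x = x := by
    have h1 : star x * (x * y * star x * x - x) = 0 := by
      rw [mul_sub, sub_eq_zero]
      simpa only [mul_assoc] using hy
    have h2 : star (x * y * star x * x - x) =
        star x * x * star y * star x - star x := by
      simp only [star_sub, star_mul, star_star, mul_assoc]
    refine sub_eq_zero.1 (hpos _ ?_)
    rw [h2, sub_mul, mul_assoc, h1, mul_zero, sub_zero]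
  have hs : x * y * star x * star (x * y * star x) = star (x * y * star x) := by
    simp only [star_mul, star_star, ← mul_assoc, hx]
  have hs' : star (x * y * star x) = x * y * star x := by
    have h := congrArg star hs
    rw [star_mul, star_star] at h
    rw [← hs, h]
  refine ⟨x * y * star x, y * star x, ⟨?_, hs'⟩, hx, mul_assoc _ _ _⟩
  rw [hs'] at hs
  exact hs

end Algebra

namespace IsSpectralAlgebra

variable {A : Type*} [NonUnitalRing A] [StarRing A] [Module ℂ A]

theorem eq_zero_of_star_mul_self (hA : IsSpectralAlgebra A) {x : A} (h : star x * x = 0) :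
    x = 0 :=
  hA.eq_zero_of_add x 0 (by simp [h])

theorem exists_range_projection (hA : IsSpectralAlgebra A) (x : A) :
    ∃ e w : A, IsStarProjection e ∧ e * x = x ∧ e = x * w :=
  exists_range_projection_of_regular (fun _ => hA.eq_zero_of_star_mul_self) hA.regular x

/-- A least upper bound of projections annihilates every element which the projections
annihilate. -/
theorem isLUB_mul_eq_zero (hA : IsSpectralAlgebra A) {s : Set (ProjectionLattice A)}
    {p : ProjectionLattice A} (hp : IsLUB s p) {f : A} (hf : ∀ q ∈ s, q.val * f = 0) :
    p.val * f = 0 := by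
  obtain ⟨h, w, hh, hr, hw⟩ := hA.exists_range_projection (p.val * f)
  have hph : p.val * h = h := by
    rw [hw, ← mul_assoc, ← mul_assoc, p.isProj.mul_self]
  have hhp : h * p.val = h := by
    simpa [hh.star_eq, p.isProj.star_eq] using congrArg star hph
  have hle : p ≤ .of (p.val - h) (hh.sub_of_mul_eq_left p.isProj hhp) := by
    refine hp.2 fun q hq => ?_
    have hq1 : q.val * p.val = q.val := hp.1 hq
    have hq2 : q.val * h = 0 := by
      rw [hw, ← mul_assoc, ← mul_assoc, hq1, hf q hq, zero_mul]
    rw [ProjectionLattice.le_iff]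
    simp [mul_sub, hq1, hq2]
  have hh0 : h = 0 := by
    rw [ProjectionLattice.le_iff] at hle
    simpa [mul_sub, p.isProj.mul_self, hph] using hle
  rw [← hr, hh0, zero_mul]

/-- Infima are obtained from suprema: below `p₀`, the infimum of the `pₙ` is the complement of the
supremum of the range projections of `p₀ (1 - pₙ) p₀`. -/
theorem isSigmaComplete_of_upward (hA : IsSpectralAlgebra A)
    (h : IsUpwardSigmaComplete (ProjectionLattice A)) : IsSigmaComplete (ProjectionLattice A) := by
  refine ⟨h, fun s hs hsc => ?_⟩
  obtain ⟨p₀, hp₀⟩ := hs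
  choose e w he hex hew using fun p : ProjectionLattice A =>
    hA.exists_range_projection (p₀.val - p₀.val * p.val)
  obtain ⟨b, hb⟩ := h ((fun p => ProjectionLattice.of (e p) (he p)) '' s)
    ⟨_, _, hp₀, rfl⟩ (hsc.image _)
  -- the range projections lie below `p₀`
  have hb0 : b ≤ p₀ := by
    refine hb.2 ?_
    rintro _ ⟨p, hp, rfl⟩
    refine ProjectionLattice.le_of_mul_eq_right ?_
    rw [ProjectionLattice.val_of, hew, ← mul_assoc, mul_sub, ← mul_assoc, p₀.isProj.mul_self]
  have hpb : p₀.val * b.val = b.val := ProjectionLattice.mul_eq_right hb0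
  refine ⟨.of (p₀.val - b.val) (b.isProj.sub_of_mul_eq_left p₀.isProj hb0), ?_, ?_⟩
  · intro p hp
    rw [ProjectionLattice.le_iff]
    have h1 : e p * b.val = e p := hb.1 ⟨p, hp, rfl⟩
    have h2 : b.val * e p = e p := by
      simpa [(he p).star_eq, b.isProj.star_eq] using congrArg star h1
    have h3 : (p₀.val - b.val) * (p₀.val - p₀.val * p.val) = 0 := by
      rw [← hex p, sub_mul, ← mul_assoc, ← mul_assoc, h2, hew p]
      simp only [mul_sub, sub_mul, ← mul_assoc, p₀.isProj.mul_self, sub_self]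
    have h4 : b.val * p₀.val = b.val := hb0
    simp only [mul_sub, sub_mul, ← mul_assoc, p₀.isProj.mul_self, h4] at h3
    rw [ProjectionLattice.val_of, sub_mul]
    exact (sub_eq_zero.1 h3).symm
  · intro q hq
    have hq0 : q.val * p₀.val = q.val := hq hp₀
    have h1 : b.val * q.val = 0 := by
      refine hA.isLUB_mul_eq_zero hb ?_
      rintro _ ⟨p, hp, rfl⟩
      have hqp : q.val * p.val = q.val := hq hp
      have h2 : q.val * e p = 0 := by
        rw [hew, ← mul_assoc, mul_sub, ← mul_assoc, hq0, hqp, sub_self, zero_mul]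
      exact q.isProj.mul_eq_zero_comm (he p) h2
    rw [ProjectionLattice.le_iff, ProjectionLattice.val_of, mul_sub, hq0, b.isProj.mul_eq_zero_comm q.isProj h1, sub_zero]

end IsSpectralAlgebra

namespace IsSpectralAlgebra

theorem spectral_mul {A : Type*} [NonUnitalRing A] [StarRing A] [Module ℂ A]
    [IsScalarTower ℂ A A] {s : Finset ℝ} {p : ℝ → A} (hp : ∀ c ∈ s, IsStarProjection (p c))
    (ho : ∀ c ∈ s, ∀ d ∈ s, c ≠ d → p c * p d = 0) {c : ℝ} (hc : c ∈ s) :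
    (∑ d ∈ s, (d : ℂ) • p d) * p c = (c : ℂ) • p c := by
  rw [Finset.sum_mul, Finset.sum_eq_single c]
  · rw [smul_mul_assoc, (hp c hc).mul_self]
  · intro d hd hdc
    rw [smul_mul_assoc, ho d hd c hc hdc, smul_zero]
  · exact fun h => absurd hc h

theorem mul_spectral {A : Type*} [NonUnitalRing A] [StarRing A] [Module ℂ A]
    [SMulCommClass ℂ A A] {s : Finset ℝ} {p : ℝ → A} (hp : ∀ c ∈ s, IsStarProjection (p c))
    (ho : ∀ c ∈ s, ∀ d ∈ s, c ≠ d → p c * p d = 0) {c : ℝ} (hc : c ∈ s) :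
    p c * (∑ d ∈ s, (d : ℂ) • p d) = (c : ℂ) • p c := by
  rw [Finset.mul_sum, Finset.sum_eq_single c]
  · rw [mul_smul_comm, (hp c hc).mul_self]
  · intro d hd hdc
    rw [mul_smul_comm, ho c hc d hd hdc.symm, smul_zero]
  · exact fun h => absurd hc h

variable {A : Type*} [NonUnitalRing A] [StarRing A] [Module ℂ A] [IsScalarTower ℂ A A]
  [SMulCommClass ℂ A A]

/-- A self-adjoint element has only finitely many eigenvalues. -/
theorem finite_eigenvalues (hA : IsSpectralAlgebra A) {x : A} (hx : IsSelfAdjoint x) :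
    {c : ℂ | ∃ e : A, e ≠ 0 ∧ x * e = c • e}.Finite := by
  obtain ⟨s, p, -, hp, ho, rfl⟩ := hA.spectral x hx
  refine ((s.image ((↑) : ℝ → ℂ)).finite_toSet.union (Set.finite_singleton 0)).subset ?_
  rintro c ⟨e, he, hce⟩
  by_contra hc
  simp only [Finset.coe_image, Set.mem_union, Set.mem_image, Finset.mem_coe,
    Set.mem_singleton_iff, not_or, not_exists, not_and] at hc
  have h0 : ∀ d ∈ s, p d * e = 0 := by
    intro d hd
    have h1 := congrArg (p d * ·) hce
    simp only [← mul_assoc, mul_spectral hp ho hd, smul_mul_assoc, mul_smul_comm] at h1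
    have h2 : ((d : ℂ) - c) • (p d * e) = 0 := by rw [sub_smul, h1, sub_self]
    exact (smul_eq_zero.1 h2).resolve_left (sub_ne_zero.2 (hc.1 d hd))
  have h1 : (0 : A) = c • e := by
    rw [← hce, Finset.sum_mul]
    exact (Finset.sum_eq_zero fun d hd => by rw [smul_mul_assoc, h0 d hd, smul_zero]).symm
  exact (smul_ne_zero hc.2 he) h1.symm

end IsSpectralAlgebra

namespace IsSpectralAlgebra

variable {A : Type*} [NonUnitalRing A] [StarRing A] [Module ℂ A] [IsScalarTower ℂ A A]
  [SMulCommClass ℂ A A] [StarModule ℂ A]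

/-- Below every nonzero element there is a partial isometry, obtained from a nonzero spectral
projection of `x⋆ x`. -/
theorem exists_partial_isometry (hA : IsSpectralAlgebra A) {x : A} (hx : x ≠ 0) :
    ∃ v a b : A, v ≠ 0 ∧ IsStarProjection (star v * v) ∧ v * (star v * v) = v ∧
      v = x * a ∧ star v = star x * b := by
  obtain ⟨s, p, h0, hp, ho, hs⟩ := hA.spectral (star x * x) (.star_mul_self x)
  have hne : ∃ c ∈ s, p c ≠ 0 := by
    by_contra! h
    refine hx (hA.eq_zero_of_star_mul_self ?_)
    rw [hs]
    exact Finset.sum_eq_zero fun c hc => by rw [h c hc, smul_zero]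
  obtain ⟨c, hc, hpc⟩ := hne
  have hc0 : c ≠ 0 := fun h => h0 (h ▸ hc)
  have hq := hp c hc
  have hmul : star x * (x * p c) = (c : ℂ) • p c := by
    rw [← mul_assoc, hs, spectral_mul hp ho hc]
  have hpos : 0 < c := by
    by_contra hneg
    have hneg' : 0 ≤ -c := by linarith
    have h1 := hA.eq_zero_of_add (((√(-c) : ℝ) : ℂ) • p c) (x * p c) (by
      have h2 : ((√(-c) : ℝ) : ℂ) * ((√(-c) : ℝ) : ℂ) = -c := by
        rw [← Complex.ofReal_mul, Real.mul_self_sqrt hneg']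
        simp
      rw [star_mul, mul_assoc, hmul, star_smul, hq.star_eq, smul_mul_smul_comm, hq.mul_self,
        mul_smul_comm, hq.mul_self]
      simp [h2])
    refine (smul_ne_zero ?_ hpc) h1
    simp only [ne_eq, Complex.ofReal_eq_zero]
    exact Real.sqrt_ne_zero'.2 (lt_of_le_of_ne hneg' (by simpa [eq_comm] using hc0))
  set t : ℂ := (((√c)⁻¹ : ℝ) : ℂ) with ht
  have htt : t * t * c = 1 := by
    rw [ht, ← Complex.ofReal_mul, ← Complex.ofReal_mul, ← mul_inv, Real.mul_self_sqrt hpos.le,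
      inv_mul_cancel₀ hc0, Complex.ofReal_one]
  have hst : star t = t := by simp [ht]
  have hvv : star (t • (x * p c)) * (t • (x * p c)) = p c := by
    rw [star_smul, smul_mul_smul_comm, star_mul, mul_assoc, hmul, mul_smul_comm, hq.star_eq,
      hq.mul_self, smul_smul, hst, htt, one_smul]
  refine ⟨t • (x * p c), t • p c, (t * (c : ℂ)⁻¹) • (x * p c * star x), ?_, ?_, ?_, ?_, ?_⟩
  · intro h
    rw [h, mul_zero] at hvv
    exact hpc hvv.symm
  · rw [hvv]; exact hq
  · rw [hvv, smul_mul_assoc, mul_assoc, hq.mul_self]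
  · rw [mul_smul_comm]
  · rw [star_smul, star_mul, hq.star_eq, mul_smul_comm, ← mul_assoc, hmul, smul_mul_assoc,
      smul_smul, hst,      mul_assoc, inv_mul_cancel₀ (by exact_mod_cast hc0), mul_one]

end IsSpectralAlgebra

/-! ### The obstruction to upward `σ`-completeness -/

namespace IsSpectralAlgebra

variable {A : Type*} [NonUnitalRing A] [StarRing A] [Module ℂ A] [IsScalarTower ℂ A A]
  [SMulCommClass ℂ A A] [StarModule ℂ A]

/-- The projection onto the graph of `t v`, where `v` is a partial isometry of square zero with
initial projection `p`: it is the range projection of `u = p + t v`, and its compression to `p` is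
`(1 + t²)⁻¹ p`. The factorizations of `r` transfer to it the orthogonality of such `v`. -/
theorem exists_graph_projection {v : A} (hv : IsStarProjection (star v * v))
    (hvp : v * (star v * v) = v) (hvv : v * v = 0) (t : ℝ) :
    ∃ r a b : A, IsStarProjection r ∧
      star v * v * r * (star v * v) = (((1 + t ^ 2)⁻¹ : ℝ) : ℂ) • (star v * v) ∧
      r = (star v * v + (t : ℂ) • v) * a ∧ r = b * (star v * v + (t : ℂ) • star v) := by
  set p := star v * v with hp
  have hvs : star v * star v = 0 := by rw [← star_mul, hvv, star_zero]
  have hpv : p * v = 0 := by rw [hp, mul_assoc, hvv, mul_zero]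
  have hsp : star v * p = 0 := by rw [hp, ← mul_assoc, hvs, zero_mul]
  set u := p + (t : ℂ) • v with hu
  clear_value u
  have hus : star u = p + (t : ℂ) • star v := by
    rw [hu, star_add, star_smul, hv.star_eq]; simp
  have hup : u * p = u := by rw [hu, add_mul, hv.mul_self, smul_mul_assoc, hvp]
  have huu : star u * u = ((1 + t ^ 2 : ℝ) : ℂ) • p := by
    rw [hus, hu, add_mul, mul_add, mul_add, hv.mul_self, mul_smul_comm, hpv, smul_mul_assoc, hsp,
      smul_mul_smul_comm, ← hp]
    simp only [smul_zero, add_zero, zero_add, Complex.ofReal_add, Complex.ofReal_one,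
      Complex.ofReal_mul, add_smul, one_smul, pow_two]
  clear_value p
  have hpu : p * u = p := by rw [hu, mul_add, hv.mul_self, mul_smul_comm, hpv, smul_zero, add_zero]
  have hpu' : star u * p = p := by
    rw [hus, add_mul, hv.mul_self, smul_mul_assoc, hsp, smul_zero, add_zero]
  have h1 : (1 + t ^ 2 : ℝ) ≠ 0 := by positivity
  have h1' : (((1 + t ^ 2)⁻¹ : ℝ) : ℂ) * ((1 + t ^ 2 : ℝ) : ℂ) = 1 := by
    rw [← Complex.ofReal_mul, inv_mul_cancel₀ h1, Complex.ofReal_one]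
  set k : ℂ := (((1 + t ^ 2)⁻¹ : ℝ) : ℂ) with hk
  have hks : star k = k := by simp [hk]
  refine ⟨k • (u * star u), k • star u, k • u, ⟨?_, ?_⟩, ?_, ?_, ?_⟩
  · change k • (u * star u) * k • (u * star u) = _
    rw [smul_mul_smul_comm, mul_assoc, ← mul_assoc (star u), huu, smul_mul_assoc, mul_smul_comm,
      ← mul_assoc, hup, smul_smul, mul_assoc, h1', mul_one]
  · change star (k • (u * star u)) = _
    rw [star_smul, hks, star_mul, star_star]
  · rw [mul_smul_comm, smul_mul_assoc, ← mul_assoc, hpu, mul_assoc, hpu', hv.mul_self]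
  · rw [mul_smul_comm]
  · rw [smul_mul_assoc, hus]

/-- The reason for which an upward `σ`-complete projection lattice forces the algebra to be almost
commutative. For an orthogonal sequence of `2 × 2` matrix units `vₙ`, let `P` be the supremum of the
initial projections `pₙ` and `Q` the supremum of the projections onto the graphs of `n vₙ`. Then
`P Q P` has the infinitely many eigenvalues `(1 + n²)⁻¹`. -/
theorem not_orthogonal_sequence (hA : IsSpectralAlgebra A)
    (hs : IsUpwardSigmaComplete (ProjectionLattice A)) (v : ℕ → A)
    (h0 : ∀ n, v n ≠ 0) (hp : ∀ n, IsStarProjection (star (v n) * v n))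
    (hvp : ∀ n, v n * (star (v n) * v n) = v n) (hvv : ∀ m n, v m * v n = 0)
    (hsv : ∀ m n, m ≠ n → star (v m) * v n = 0) (hvs : ∀ m n, m ≠ n → v m * star (v n) = 0) :
    False := by
  choose r a b hr hprp hra hrb using fun n : ℕ =>
    exists_graph_projection (hp n) (hvp n) (hvv n n) (n : ℝ)
  obtain ⟨p, hpn⟩ : ∃ p : ℕ → A, ∀ n, star (v n) * v n = p n := ⟨_, fun _ => rfl⟩
  simp only [hpn] at hp hvp hprp hra hrb
  have hss : ∀ m n, star (v m) * star (v n) = 0 := fun m n => by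
    rw [← star_mul, hvv, star_zero]
  have hpp : ∀ m n, m ≠ n → p m * p n = 0 := fun m n hmn => by
    simp only [← hpn, mul_assoc]
    rw [mul_mul_eq_of_mul_eq (hvs m n hmn), zero_mul, mul_zero]
  have hpr : ∀ m n, m ≠ n → p m * r n = 0 := fun m n hmn => by
    rw [hra, ← mul_assoc, mul_add, mul_smul_comm, hpp m n hmn, ← hpn, mul_assoc, hvv]
    simp only [mul_zero, smul_zero, add_zero, zero_mul]
  have hrp : ∀ m n, m ≠ n → r m * p n = 0 := fun m n hmn =>
    (hp n).mul_eq_zero_comm (hr m) (hpr n m hmn.symm)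
  have hrr : ∀ m n, m ≠ n → r m * r n = 0 := fun m n hmn => by
    have h1 : star (v m) * r n = 0 := by
      rw [hra, ← mul_assoc, mul_add, mul_smul_comm, hsv m n hmn, ← hpn, ← mul_assoc, hss]
      simp
    rw [hrb, mul_assoc, add_mul, smul_mul_assoc, h1, hpr m n hmn]
    simp
  obtain ⟨P, hP⟩ := hs (Set.range fun n => ProjectionLattice.of (p n) (hp n))
    (Set.range_nonempty _) (Set.countable_range _)
  obtain ⟨Q, hQ⟩ := hs (Set.range fun n => ProjectionLattice.of (r n) (hr n))
    (Set.range_nonempty _) (Set.countable_range _)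
  have hPp : ∀ n, P.val * p n = p n := fun n => ProjectionLattice.mul_eq_right (hP.1 ⟨n, rfl⟩)
  have hQr : ∀ n, Q.val * r n = r n := fun n => ProjectionLattice.mul_eq_right (hQ.1 ⟨n, rfl⟩)
  have hQp : ∀ n, Q.val * p n = r n * p n := fun n => by
    have h1 : Q.val * (p n - r n * p n) = 0 := by
      refine hA.isLUB_mul_eq_zero hQ ?_
      rintro _ ⟨m, rfl⟩
      rw [ProjectionLattice.val_of, mul_sub, ← mul_assoc]
      rcases eq_or_ne m n with rfl | hmn
      · rw [(hr m).mul_self, sub_self]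
      · rw [hrp m n hmn, hrr m n hmn, zero_mul, sub_self]
    rwa [mul_sub, sub_eq_zero, ← mul_assoc, hQr] at h1
  have hPrp : ∀ n, P.val * (r n * p n) = p n * r n * p n := fun n => by
    have h1 : P.val * (r n * p n - p n * r n * p n) = 0 := by
      refine hA.isLUB_mul_eq_zero hP ?_
      rintro _ ⟨m, rfl⟩
      rw [ProjectionLattice.val_of, mul_sub, ← mul_assoc, ← mul_assoc, ← mul_assoc]
      rcases eq_or_ne m n with rfl | hmn
      · rw [(hp m).mul_self, sub_self]
      · rw [hpr m n hmn, hpp m n hmn, zero_mul, zero_mul, zero_mul, sub_self]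
    rw [mul_sub, sub_eq_zero, ← mul_assoc, ← mul_assoc, ← mul_assoc, hPp] at h1
    rwa [← mul_assoc]
  have hx : IsSelfAdjoint (P.val * Q.val * P.val) := by
    rw [IsSelfAdjoint, star_mul, star_mul, P.isProj.star_eq, Q.isProj.star_eq, mul_assoc]
  have hinj : Function.Injective fun n : ℕ => (((1 + (n : ℝ) ^ 2)⁻¹ : ℝ) : ℂ) := by
    intro m n hmn
    have h1 : ((m : ℝ) ^ 2) = (n : ℝ) ^ 2 := by
      have h2 := Complex.ofReal_injective hmn
      simpa using h2
    exact_mod_cast (pow_left_inj₀ (Nat.cast_nonneg m) (Nat.cast_nonneg n) two_ne_zero).1 h1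
  refine Set.infinite_range_of_injective hinj ((hA.finite_eigenvalues hx).subset ?_)
  rintro _ ⟨n, rfl⟩
  refine ⟨p n, fun h => h0 n (hA.eq_zero_of_star_mul_self ((hpn n).trans h)), ?_⟩
  rw [mul_assoc, hPp, mul_assoc, hQp, hPrp]
  exact hprp n

/-! ### Minimal projections -/

/-- A minimal projection: a nonzero projection which dominates no projection other than `0` and
itself. -/
structure _root_.IsMinimalProjection {A : Type*} [NonUnitalRing A] [StarRing A] (p : A) :
    Prop where
  isProj : IsStarProjection p
  ne_zero : p ≠ 0
  eq_zero_or_eq : ∀ r : A, IsStarProjection r → r * p = r → r = 0 ∨ r = p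

/-- A nonzero partial isometry `v` with `v² = 0`, that is, with orthogonal initial and final
projections: the off-diagonal entry of a system of `2 × 2` matrix units. -/
structure _root_.IsMatrixUnit {A : Type*} [NonUnitalRing A] [StarRing A] (v : A) : Prop where
  ne_zero : v ≠ 0
  isProj : IsStarProjection (star v * v)
  mul_isProj : v * (star v * v) = v
  mul_self : v * v = 0

theorem _root_.IsMatrixUnit.isProj_mul_star {A : Type*} [NonUnitalRing A] [StarRing A] {v : A}
    (hv : IsMatrixUnit v) : star v * v * star v = star v := by
  have h := congrArg star hv.mul_isProj
  rwa [star_mul, hv.isProj.star_eq] at h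

theorem _root_.IsMatrixUnit.star_mul_self_mul {A : Type*} [NonUnitalRing A] [StarRing A] {v q : A}
    (hv : IsMatrixUnit v) (hq : IsStarProjection q) (hqv : q * (star v * v) = q) :
    star (v * q) * (v * q) = q := by
  rw [star_mul, hq.star_eq, mul_assoc, ← mul_assoc (star v), hq.mul_eq_left_comm hv.isProj hqv,
    hq.mul_self]

theorem _root_.IsMatrixUnit.mul_projection {A : Type*} [NonUnitalRing A] [StarRing A] {v q : A}
    (hv : IsMatrixUnit v) (hq : IsStarProjection q) (hq0 : q ≠ 0)
    (hqv : q * (star v * v) = q) : IsMatrixUnit (v * q) := by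
  have h := hv.star_mul_self_mul hq hqv
  refine ⟨?_, h.symm ▸ hq, by rw [h, mul_assoc, hq.mul_self], ?_⟩
  · intro h0
    rw [h0, mul_zero] at h
    exact hq0 h.symm
  · rw [← hqv]
    simp only [mul_assoc]
    rw [mul_mul_eq_of_mul_eq hv.mul_self]
    simp

/-- Under an upward `σ`-complete projection lattice, the initial projection of a matrix unit
dominates a minimal projection. -/
theorem exists_minimal_le (hA : IsSpectralAlgebra A)
    (hs : IsUpwardSigmaComplete (ProjectionLattice A)) {v : A} (hv : IsMatrixUnit v) :
    ∃ q, IsMinimalProjection q ∧ q * (star v * v) = q := by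
  by_contra! hcon
  have hstep : ∀ q : {q : A // IsStarProjection q ∧ q ≠ 0 ∧ q * (star v * v) = q},
      ∃ r : {q : A // IsStarProjection q ∧ q ≠ 0 ∧ q * (star v * v) = q},
        r.1 * q.1 = r.1 ∧ r.1 ≠ q.1 := by
    rintro ⟨q, hq, hq0, hqv⟩
    by_contra! h
    refine hcon q ⟨hq, hq0, fun r hr hrq => ?_⟩ hqv
    by_contra! hr0
    exact hr0.2 (h ⟨r, hr, hr0.1, by rw [← hrq, mul_assoc, hqv]⟩ hrq)
  choose f hf hfne using hstep
  -- a strictly decreasing sequence of projections, and its orthogonal sequence of differences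
  set q : ℕ → {q : A // IsStarProjection q ∧ q ≠ 0 ∧ q * (star v * v) = q} := fun n =>
    f^[n] ⟨star v * v, hv.isProj, fun h => hv.ne_zero (hA.eq_zero_of_star_mul_self h),
      hv.isProj.mul_self⟩ with hqdef
  have hsucc : ∀ n, q (n + 1) = f (q n) := fun n => Function.iterate_succ_apply' f n _
  have hle : ∀ m n, m ≤ n → (q n).1 * (q m).1 = (q n).1 := by
    intro m n hmn
    induction n, hmn using Nat.le_induction with
    | base => exact (q m).2.1.mul_self
    | succ n _ ih =>
      rw [hsucc, ← hf (q n), mul_assoc, ih]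
  set d : ℕ → A := fun n => (q n).1 - (q (n + 1)).1 with hddef
  have hd : ∀ n, IsStarProjection (d n) := fun n =>
    (q (n + 1)).2.1.sub_of_mul_eq_left (q n).2.1 (hle n (n + 1) n.le_succ)
  have hd0 : ∀ n, d n ≠ 0 := fun n h => hfne (q n) (by
    rw [← hsucc]; exact (sub_eq_zero.1 h).symm)
  have hdv : ∀ n, d n * (star v * v) = d n := fun n => by
    simp only [hddef, sub_mul, (q n).2.2.2, (q (n + 1)).2.2.2]
  have hlt : ∀ m n, m < n → d n * d m = 0 := fun m n hmn => by
    simp only [hddef, sub_mul, mul_sub, hle m n hmn.le, hle (m + 1) n hmn,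
      hle m (n + 1) (by omega), hle (m + 1) (n + 1) (by omega), sub_self]
  have hdd : ∀ m n, m ≠ n → d m * d n = 0 := fun m n hmn => by
    rcases lt_or_gt_of_ne hmn with h | h
    · exact (hd n).mul_eq_zero_comm (hd m) (hlt m n h)
    · exact hlt n m h
  have hu : ∀ n, IsMatrixUnit (v * d n) := fun n => hv.mul_projection (hd n) (hd0 n) (hdv n)
  have hdv' : ∀ n, d n * v = 0 := fun n => by
    rw [← hdv n]
    simp only [mul_assoc, hv.mul_self, mul_zero]
  refine hA.not_orthogonal_sequence hs (fun n => v * d n) (fun n => (hu n).ne_zero)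
    (fun n => (hu n).isProj) (fun n => (hu n).mul_isProj) (fun m n => ?_) (fun m n hmn => ?_)
    (fun m n hmn => ?_)
  · rw [mul_assoc, ← mul_assoc (d m), hdv', zero_mul, mul_zero]
  · rw [star_mul, (hd m).star_eq, mul_assoc, ← mul_assoc (star v),
      (hd n).mul_eq_left_comm hv.isProj (hdv n), hdd m n hmn]
  · rw [star_mul, (hd n).star_eq, mul_assoc, ← mul_assoc (d m), hdd m n hmn, zero_mul, mul_zero]

omit [StarModule ℂ A] in
theorem compression_mem_span_of_isSelfAdjoint (hA : IsSpectralAlgebra A) {q : A}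
    (hq : IsMinimalProjection q) {x : A} (hx : IsSelfAdjoint x) :
    q * x * q ∈ Submodule.span ℂ {q} := by
  have hy : IsSelfAdjoint (q * x * q) := by
    rw [IsSelfAdjoint, star_mul, star_mul, hq.isProj.star_eq, hx.star_eq, mul_assoc]
  obtain ⟨s, p, h0, hp, ho, hsum⟩ := hA.spectral _ hy
  rw [hsum]
  refine Submodule.sum_mem _ fun c hc => Submodule.smul_mem _ _ ?_
  have hc0 : (c : ℂ) ≠ 0 := by
    simp only [ne_eq, Complex.ofReal_eq_zero]
    exact fun h => h0 (h ▸ hc)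
  have hpq : p c * q = p c := by
    have h1 := mul_spectral hp ho hc
    rw [← hsum] at h1
    have h2 : p c = (c : ℂ)⁻¹ • (p c * (q * x * q)) := by
      rw [h1, smul_smul, inv_mul_cancel₀ hc0, one_smul]
    rw [h2, smul_mul_assoc]
    simp only [mul_assoc, hq.isProj.mul_self]
  rcases hq.eq_zero_or_eq _ (hp c hc) hpq with h | h
  · rw [h]; exact Submodule.zero_mem _
  · rw [h]; exact Submodule.mem_span_singleton_self q

/-- The corner of a minimal projection is one-dimensional. -/
theorem exists_compression_eq_smul (hA : IsSpectralAlgebra A) {q : A}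
    (hq : IsMinimalProjection q) (x : A) : ∃ z : ℂ, q * x * q = z • q := by
  have h : q * x * q ∈ Submodule.span ℂ {q} := by
    rw [← realPart_add_I_smul_imaginaryPart x, mul_add, add_mul, mul_smul_comm, smul_mul_assoc]
    exact Submodule.add_mem _ (hA.compression_mem_span_of_isSelfAdjoint hq (realPart x).2)
      (Submodule.smul_mem _ _ (hA.compression_mem_span_of_isSelfAdjoint hq (imaginaryPart x).2))
  obtain ⟨z, hz⟩ := Submodule.mem_span_singleton.1 h
  exact ⟨z, hz.symm⟩

theorem exists_star_mul_self_eq_smul (hA : IsSpectralAlgebra A) {q : A}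
    (hq : IsMinimalProjection q) {x : A} (hx : x ≠ 0) (hxq : x * q = x) :
    ∃ z : ℂ, z ≠ 0 ∧ star x * x = z • q := by
  obtain ⟨z, hz⟩ := hA.exists_compression_eq_smul hq (star x * x)
  have h : star x * x = z • q := by
    rw [← hz, ← hxq, star_mul, hq.isProj.star_eq]
    simp only [mul_assoc, mul_mul_eq_of_mul_eq hq.isProj.mul_self, hq.isProj.mul_self]
  refine ⟨z, ?_, h⟩
  rintro rfl
  exact hx (hA.eq_zero_of_star_mul_self (by rw [h, zero_smul]))

/-- The space `p A q` between two minimal projections is at most one-dimensional. -/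
theorem eq_smul_of_minimal (hA : IsSpectralAlgebra A) {p q : A} (hp : IsMinimalProjection p)
    (hq : IsMinimalProjection q) {x y : A} (hx : x ≠ 0) (hpx : p * x = x)
    (hpy : p * y = y) (hyq : y * q = y) (hxq : x * q = x) : ∃ z : ℂ, y = z • x := by
  obtain ⟨c, hc, hxx⟩ := hA.exists_star_mul_self_eq_smul hp (x := star x) (star_ne_zero.2 hx)
    (by rw [← hp.isProj.star_eq, ← star_mul, hpx])
  rw [star_star] at hxx
  obtain ⟨d, hd⟩ := hA.exists_compression_eq_smul hq (star x * y)
  have hd' : star x * y = d • q := by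
    rw [← hd, mul_assoc, mul_assoc, hyq, ← mul_assoc]
    congr 1
    rw [← hq.isProj.star_eq, ← star_mul, hxq]
  have h : c • y = d • x := by
    rw [← hpy, ← smul_mul_assoc, ← hxx, mul_assoc, hd', mul_smul_comm, hxq]
  exact ⟨c⁻¹ * d, by rw [mul_smul, ← h, smul_smul, inv_mul_cancel₀ hc, one_smul]⟩

/-- Being connected by a nonzero element is transitive on minimal projections. -/
theorem mul_ne_zero_of_minimal (hA : IsSpectralAlgebra A) {q : A} (hq : IsMinimalProjection q)
    {x y : A} (hx : x * q ≠ 0) (hy : q * y ≠ 0) : x * q * (q * y) ≠ 0 := by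
  obtain ⟨c, hc, hxx⟩ := hA.exists_star_mul_self_eq_smul hq hx
    (by rw [mul_assoc, hq.isProj.mul_self])
  intro h
  have h1 : star (x * q) * (x * q) * (q * y) = 0 := by rw [mul_assoc, h, mul_zero]
  rw [hxx, smul_mul_assoc, ← mul_assoc, hq.isProj.mul_self] at h1
  exact smul_ne_zero hc hy h1

end IsSpectralAlgebra

/-! ### Splitting off the noncommutative part -/

namespace IsSpectralAlgebra

variable {A : Type*} [NonUnitalRing A] [StarRing A] [Module ℂ A] [IsScalarTower ℂ A A]
  [SMulCommClass ℂ A A] [StarModule ℂ A]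

/-- There is no infinite orthogonal sequence of minimal projections which are initial projections of
matrix units. Being connected is transitive, so there is an infinite subsequence which is either
pairwise connected or pairwise disconnected. In the first case, consecutive projections are
connected by orthogonal matrix units; in the second case, the given matrix units are
orthogonal. -/
theorem not_orthogonal_sequence_minimal (hA : IsSpectralAlgebra A)
    (hs : IsUpwardSigmaComplete (ProjectionLattice A)) (p : ℕ → A)
    (hp : ∀ n, IsMinimalProjection (p n)) (ho : ∀ m n, m ≠ n → p m * p n = 0)
    (hv : ∀ n, ∃ v, IsMatrixUnit v ∧ star v * v = p n) : False := by
  choose v hv hvp using hv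
  let r : {q : A // IsMinimalProjection q} → {q : A // IsMinimalProjection q} → Prop :=
    fun a b => ∃ x, a.1 * x * b.1 ≠ 0
  have hr : IsTrans _ r := ⟨by
    rintro a b c ⟨x, hx⟩ ⟨y, hy⟩
    refine ⟨x * (b.1 * (b.1 * y)), ?_⟩
    have h := hA.mul_ne_zero_of_minimal b.2 hx (y := y * c.1) (by rwa [← mul_assoc])
    simpa only [mul_assoc] using h⟩
  obtain ⟨g, hg⟩ := exists_increasing_or_nonincreasing_subseq r
    fun n => (⟨p n, hp n⟩ : {q : A // IsMinimalProjection q})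
  have hgo : ∀ m n, m ≠ n → p (g m) * p (g n) = 0 := fun m n hmn =>
    ho _ _ fun h => hmn (g.injective h)
  rcases hg with hg | hg
  · have hx : ∀ n : ℕ, ∃ x, p (g (2 * n)) * x * p (g (2 * n + 1)) ≠ 0 := fun n =>
      hg (2 * n) (2 * n + 1) (Nat.lt_succ_self _)
    choose x hx using hx
    choose w a b hw hwp hww hwa hwb using fun n => hA.exists_partial_isometry (hx n)
    have hl : ∀ n, p (g (2 * n)) * w n = w n := fun n => by
      rw [hwa]
      simp only [← mul_assoc, (hp _).isProj.mul_self]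
    have hr : ∀ n, w n * p (g (2 * n + 1)) = w n := fun n => by
      have h : p (g (2 * n + 1)) * star (w n) = star (w n) := by
        rw [hwb, star_mul, (hp _).isProj.star_eq, ← mul_assoc, ← mul_assoc,
          (hp _).isProj.mul_self]
      simpa [(hp _).isProj.star_eq] using congrArg star h
    refine hA.not_orthogonal_sequence hs w hw hwp hww (fun m n => ?_) (fun m n hmn => ?_)
      (fun m n hmn => ?_)
    · rw [← hr m, ← hl n, mul_assoc, ← mul_assoc (p _), hgo _ _ (by omega), zero_mul, mul_zero]
    · rw [← hl m, ← hl n, star_mul, (hp _).isProj.star_eq, mul_assoc, ← mul_assoc (p _),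
        hgo _ _ (by omega), zero_mul, mul_zero]
    · rw [← hr m, ← hr n, star_mul, (hp _).isProj.star_eq, mul_assoc, ← mul_assoc (p _),
        hgo _ _ (by omega), zero_mul, mul_zero]
  · have hd : ∀ m n, m ≠ n → ∀ x, p (g m) * x * p (g n) = 0 := by
      intro m n hmn x
      rcases lt_or_gt_of_ne hmn with h | h
      · by_contra hx
        exact hg m n h ⟨x, hx⟩
      · by_contra hx
        refine hg n m h ⟨star x, fun h0 => hx ?_⟩
        simpa [(hp _).isProj.star_eq, mul_assoc] using congrArg star h0
    have hr : ∀ n, v n * p n = v n := fun n => by rw [← hvp, (hv n).mul_isProj]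
    have hr' : ∀ n, p n * star (v n) = star (v n) := fun n => by
      rw [← hvp, (hv n).isProj_mul_star]
    refine hA.not_orthogonal_sequence hs (fun n => v (g n)) (fun n => (hv _).ne_zero)
      (fun n => (hv _).isProj) (fun n => (hv _).mul_isProj) (fun m n => ?_) (fun m n hmn => ?_)
      (fun m n hmn => ?_)
    · rcases eq_or_ne m n with rfl | hmn
      · exact (hv _).mul_self
      · rw [← hr (g m), ← hr (g n), mul_assoc, ← mul_assoc (p _), hd m n hmn, mul_zero]
    · rw [← hr' (g m), ← hr (g n), ← mul_assoc, mul_assoc (p _), hd m n hmn]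
    · rw [← hr (g m), ← hr' (g n), mul_assoc, ← mul_assoc (p _), hgo m n hmn, zero_mul, mul_zero]

/-- The elements annihilated by a projection `e` commute with each other as soon as the projections
among them commute with all of them. -/
theorem commute_of_projections_commute (hA : IsSpectralAlgebra A) {e : A}
    (h : ∀ f, IsStarProjection f → e * f = 0 → ∀ x, e * x = 0 → Commute f x)
    (he : IsStarProjection e) (hcen : ∀ a, e * a = a * e) {x y : A} (hx : e * x = 0)
    (hy : e * y = 0) : x * y = y * x := by
  have hsa : ∀ z, IsSelfAdjoint z → e * z = 0 → Commute z y := by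
    intro z hz hez
    obtain ⟨s, p, h0, hp, ho, hsum⟩ := hA.spectral z hz
    rw [hsum]
    refine Commute.sum_left _ _ _ fun c hc => Commute.smul_left (h _ (hp c hc) ?_ y hy) _
    have h1 := mul_spectral hp ho hc
    have hc0 : (c : ℂ) ≠ 0 := by
      simp only [ne_eq, Complex.ofReal_eq_zero]
      exact fun h => h0 (h ▸ hc)
    have h2 : e * ((c : ℂ) • p c) = 0 := by
      rw [← h1, ← hsum, ← mul_assoc, hcen, mul_assoc, hez, mul_zero]
    rw [mul_smul_comm] at h2
    exact (smul_eq_zero.1 h2).resolve_left hc0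
  have hsx : e * star x = 0 := by
    rw [hcen]
    simpa [he.star_eq] using congrArg star hx
  rw [← realPart_add_I_smul_imaginaryPart x]
  refine Commute.add_left (hsa _ (realPart x).2 ?_)
    (Commute.smul_left (hsa _ (imaginaryPart x).2 ?_) _)
  · rw [realPart_apply_coe, mul_smul_comm, mul_add, hx, hsx]; simp
  · rw [imaginaryPart_apply_coe, mul_smul_comm, mul_smul_comm, mul_sub, hx, hsx]; simp

/-- If the projection lattice is upward `σ`-complete, the algebra splits, by a central projection
`e`, into a finite-dimensional part and a commutative part. Here `e` is the sum of a maximal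
orthogonal family of minimal projections which are initial projections of matrix units. -/
theorem exists_central_projection (hA : IsSpectralAlgebra A)
    (hs : IsUpwardSigmaComplete (ProjectionLattice A)) :
    ∃ e : A, IsStarProjection e ∧ (∀ a, e * a = a * e) ∧
      (∀ x y, e * x = 0 → e * y = 0 → x * y = y * x) ∧
      ∃ V : Submodule ℂ A, FiniteDimensional ℂ V ∧ ∀ a, e * a = a → a ∈ V := by
  classical
  let N : Set A := {p | IsMinimalProjection p ∧ ∃ v, IsMatrixUnit v ∧ star v * v = p}
  let F : Set (Set A) := {M | M ⊆ N ∧ ∀ p ∈ M, ∀ q ∈ M, p ≠ q → p * q = 0}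
  obtain ⟨M, hM⟩ : ∃ M, Maximal (· ∈ F) M := by
    refine zorn_subset F fun c hcF hc => ⟨⋃₀ c, ⟨Set.sUnion_subset fun M hM => (hcF hM).1, ?_⟩,
      fun M hM => Set.subset_sUnion_of_mem hM⟩
    rintro p ⟨M₁, hM₁, hp⟩ q ⟨M₂, hM₂, hq⟩ hpq
    rcases hc.total hM₁ hM₂ with h | h
    · exact (hcF hM₂).2 p (h hp) q hq hpq
    · exact (hcF hM₁).2 p hp q (h hq) hpq
  have hfin : M.Finite := by
    by_contra hinf
    let f := Set.Infinite.natEmbedding M hinf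
    refine hA.not_orthogonal_sequence_minimal hs (fun n => (f n).1)
      (fun n => (hM.1.1 (f n).2).1) (fun m n hmn => ?_) (fun n => (hM.1.1 (f n).2).2)
    exact hM.1.2 _ (f m).2 _ (f n).2 fun h => hmn (f.injective (Subtype.ext h))
  lift M to Finset A using hfin
  have hmin : ∀ p ∈ M, IsMinimalProjection p := fun p hp => (hM.1.1 hp).1
  set e : A := ∑ p ∈ M, p with he_def
  have hpe : ∀ p ∈ M, p * e = p := fun p hp => by
    rw [he_def, Finset.mul_sum, Finset.sum_eq_single p]
    · exact (hmin p hp).isProj.mul_self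
    · exact fun q hq hqp => hM.1.2 p hp q hq hqp.symm
    · exact fun h => absurd hp h
  have he : IsStarProjection e := by
    constructor
    · change e * e = e
      conv_lhs => rw [he_def, Finset.sum_mul]
      exact Finset.sum_congr rfl hpe
    · rw [IsSelfAdjoint, he_def, star_sum]
      exact Finset.sum_congr rfl fun p hp => (hmin p hp).isProj.star_eq
  have hep : ∀ p ∈ M, e * p = p := fun p hp => (hmin p hp).isProj.mul_eq_left_comm he (hpe p hp)
  -- by maximality, `e` meets the initial projection of every matrix unit
  have hmax : ∀ v, IsMatrixUnit v → v * e ≠ 0 := by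
    intro v hv hve
    obtain ⟨q, hq, hqv⟩ := hA.exists_minimal_le hs hv
    have hqe : q * e = 0 := by
      rw [← hqv, mul_assoc, mul_assoc, hve, mul_zero, mul_zero]
    have hqN : q ∈ N := ⟨hq, v * q, hv.mul_projection hq.isProj hq.ne_zero hqv,
      hv.star_mul_self_mul hq.isProj hqv⟩
    have hqp : ∀ p ∈ M, q * p = 0 := fun p hp => by
      rw [← hep p hp, ← mul_assoc, hqe, zero_mul]
    have hins : insert q (M : Set A) ∈ F := by
      refine ⟨Set.insert_subset hqN hM.1.1, ?_⟩
      rintro p₁ (rfl | hp₁) p₂ (rfl | hp₂) hne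
      · exact absurd rfl hne
      · exact hqp p₂ hp₂
      · exact hq.isProj.mul_eq_zero_comm (hmin p₁ hp₁).isProj (hqp p₁ hp₁)
      · exact hM.1.2 _ hp₁ _ hp₂ hne
    have hqM : q ∈ M := hM.2 hins (Set.subset_insert q _) (Set.mem_insert q _)
    exact hq.ne_zero (by rw [← hpe q hqM, hqe])
  have hcorner : ∀ a, e * a = e * a * e := by
    intro a
    by_contra hne
    obtain ⟨v, b, c, hv0, hvp, hvv, hvb, hvc⟩ :=
      hA.exists_partial_isometry (sub_ne_zero.2 hne)
    have hev : e * v = v := by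
      rw [hvb, ← mul_assoc, mul_sub, ← mul_assoc, ← mul_assoc, ← mul_assoc, he.mul_self]
    have hve : v * e = 0 := by
      have h : e * star v = 0 := by
        rw [hvc, ← mul_assoc]
        simp only [star_sub, star_mul, he.star_eq, mul_sub, ← mul_assoc]
        simp only [mul_assoc, he.mul_self, sub_self]
        simp
      simpa [he.star_eq] using congrArg star h
    refine hmax v ⟨hv0, hvp, hvv, ?_⟩ hve
    conv_lhs => rw [← hev, ← mul_assoc, hev, hve, zero_mul]
  have hcen : ∀ a, e * a = a * e := by
    intro a
    have h := congrArg star (hcorner (star a))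
    simp only [star_mul, star_star, he.star_eq] at h
    rw [hcorner, h, mul_assoc]
  refine ⟨e, he, hcen, fun x y hx hy => ?_, ?_⟩
  · refine hA.commute_of_projections_commute ?_ he hcen hx hy
    -- a projection `f` and an element `x` of the complement with `(1 - f) x f ≠ 0` would give
    -- a matrix unit that `e` annihilates
    have hkey : ∀ f, IsStarProjection f → e * f = 0 → ∀ x, x * f = f * x * f := by
      intro f hf hef x
      by_contra hne
      obtain ⟨v, b, c, hv0, hvp, hvv, hvb, hvc⟩ :=
        hA.exists_partial_isometry (sub_ne_zero.2 hne)
      have hfv : f * v = 0 := by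
        rw [hvb, ← mul_assoc, mul_sub, ← mul_assoc, ← mul_assoc, ← mul_assoc, hf.mul_self,
          sub_self, zero_mul]
      have hvf : v * f = v := by
        have h : f * star v = star v := by
          rw [hvc, ← mul_assoc]
          have h0 : (x * f - f * x * f) * f = x * f - f * x * f := by
            simp only [sub_mul, mul_assoc, hf.mul_self]
          have h1 := congrArg star h0
          rw [star_mul, hf.star_eq] at h1
          rw [h1]
        simpa [hf.star_eq] using congrArg star h
      refine hmax v ⟨hv0, hvp, hvv, ?_⟩ ?_
      · rw [← hvf, mul_assoc, ← mul_assoc f, hfv, zero_mul, mul_zero]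
      · rw [← hvf, mul_assoc, ← hcen, hef, mul_zero]
    intro f hf hef x _
    have h1 := hkey f hf hef x
    have h2 := congrArg star (hkey f hf hef (star x))
    simp only [star_mul, star_star, hf.star_eq] at h2
    change f * x = x * f
    rw [h2, ← mul_assoc, ← h1]
  · have hspan : ∀ p q : A, ∃ x, p ∈ M → q ∈ M → ∀ a, ∃ z : ℂ, p * a * q = z • x := by
      intro p q
      by_cases h : p ∈ M ∧ q ∈ M ∧ ∃ a, p * a * q ≠ 0
      · obtain ⟨hp, hq, a, ha⟩ := h
        have hpp := (hmin p hp).isProj.mul_self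
        have hqq := (hmin q hq).isProj.mul_self
        refine ⟨p * a * q, fun _ _ b => hA.eq_smul_of_minimal (hmin p hp) (hmin q hq) ha ?_ ?_ ?_
          ?_⟩
        · rw [← mul_assoc, ← mul_assoc, hpp]
        · rw [← mul_assoc, ← mul_assoc, hpp]
        · rw [mul_assoc, hqq]
        · rw [mul_assoc, hqq]
      · refine ⟨0, fun hp hq a => ⟨0, ?_⟩⟩
        by_contra hne
        exact h ⟨hp, hq, a, by simpa using hne⟩
    choose x hx using hspan
    refine ⟨Submodule.span ℂ ((M ×ˢ M).image fun pq => x pq.1 pq.2 : Finset A),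
      FiniteDimensional.span_finset ℂ _, fun a ha => ?_⟩
    have hsum : a = ∑ p ∈ M, ∑ q ∈ M, p * a * q := by
      have h1 : a = e * a * e := by rw [← hcorner, ha]
      rw [he_def, Finset.sum_mul, Finset.sum_mul] at h1
      exact h1.trans (Finset.sum_congr rfl fun p _ => Finset.mul_sum _ _ _)
    rw [hsum]
    refine Submodule.sum_mem _ fun p hp => Submodule.sum_mem _ fun q hq => ?_
    obtain ⟨z, hz⟩ := hx p q hp hq a
    rw [hz]
    exact Submodule.smul_mem _ _ (Submodule.subset_span (Finset.mem_coe.2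
      (Finset.mem_image.2 ⟨(p, q), Finset.mem_product.2 ⟨hp, hq⟩, rfl⟩)))

end IsSpectralAlgebra

/-! ### R*-algebras are spectral -/

/-- If `y` is invertible in a corner `e B e`, then `0` is isolated in the spectrum of `y`. -/
theorem exists_gap_of_corner_inverse {B : Type*} [NormedRing B] [NormedAlgebra ℝ B]
    [CompleteSpace B] {y e g : B} (he : e * e = e) (hey : e * y = y) (hye : y * e = y)
    (hyg : y * g = e) (hgy : g * y = e) (heg : e * g = g) (hge : g * e = g) :
    ∃ δ > (0 : ℝ), ∀ c : ℝ, c ≠ 0 → |c| < δ → c ∉ spectrum ℝ y := by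
  refine ⟨(‖g‖ + 1)⁻¹, by positivity, fun c hc hcδ => ?_⟩
  have hsmall : ‖c • g‖ < 1 := by
    rw [norm_smul, Real.norm_eq_abs]
    have h1 : |c| * (‖g‖ + 1) < 1 := by
      rwa [lt_inv_comm₀ (abs_pos.2 hc) (by positivity), ← one_div, lt_div_iff₀ (abs_pos.2 hc),
        mul_comm] at hcδ
    nlinarith [abs_nonneg c]
  have hu1 : IsUnit (1 - c • g) := (Units.oneSub _ hsmall).isUnit
  -- `c - y` is the product of this unit and of a unit which is `-y` on the corner and `c` off it
  have hu2 : IsUnit (c • (1 - e) - y) := by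
    have h1 : (c • (1 - e) - y) * (c⁻¹ • (1 - e) - g) = 1 := by
      simp only [sub_mul, mul_sub, smul_mul_assoc, mul_smul_comm, mul_one, one_mul, he, hye, heg,
        hyg, sub_self, smul_zero, zero_sub, sub_neg_eq_add, sub_add_cancel]
      rw [smul_smul, inv_mul_cancel₀ hc, one_smul, sub_add_cancel]
    have h2 : (c⁻¹ • (1 - e) - g) * (c • (1 - e) - y) = 1 := by
      simp only [sub_mul, mul_sub, smul_mul_assoc, mul_smul_comm, mul_one, one_mul, he, hey, hge,
        hgy, sub_self, smul_zero, zero_sub, sub_neg_eq_add, sub_add_cancel]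
      rw [smul_smul, mul_inv_cancel₀ hc, one_smul, sub_add_cancel]
    exact ⟨⟨_, _, h1, h2⟩, rfl⟩
  rw [spectrum.notMem_iff]
  have h : algebraMap ℝ B c - y = (c • (1 - e) - y) * (1 - c • g) := by
    simp only [sub_mul, mul_sub, smul_mul_assoc, mul_smul_comm, mul_one, one_mul, heg, hyg,
      sub_self, smul_zero, Algebra.algebraMap_eq_smul_one, smul_sub]
    abel
  rw [h]
  exact hu2.mul hu1

open Filter Topology in
/-- If `0` is isolated in the spectrum of `x² - a x` for every real `a`, then `x` has finite
spectrum: an accumulation point `a` would make `0` an accumulation point for `x² - a x`. -/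
theorem finite_spectrum_of_gap {B : Type*} [CStarAlgebra B] {x : B}
    (h : ∀ a : ℝ, ∃ δ > (0 : ℝ), ∀ c : ℝ, c ≠ 0 → |c| < δ → c ∉ spectrum ℝ (x * x - a • x)) :
    (spectrum ℝ x).Finite := by
  by_contra hinf
  obtain ⟨a, -, ha⟩ := Set.Infinite.exists_accPt_of_subset_isCompact hinf
    (ContinuousFunctionalCalculus.isCompact_spectrum (R := ℝ) (p := IsSelfAdjoint) x)
    subset_rfl
  obtain ⟨δ, hδ, hgap⟩ := h a
  rw [accPt_iff_frequently_nhdsNE] at ha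
  refine ha ?_
  have hc : ContinuousAt (fun c : ℝ => |c * c - a * c|) a := by fun_prop
  have h1 : ∀ᶠ c in 𝓝[≠] a, |c * c - a * c| < δ :=
    (hc.eventually_lt continuousAt_const (by simpa using hδ)).filter_mono nhdsWithin_le_nhds
  have h2 : ∀ᶠ c in 𝓝[≠] a, c ≠ 0 := by
    rcases eq_or_ne a 0 with rfl | ha0
    · exact eventually_mem_nhdsWithin
    · exact (eventually_ne_nhds ha0).filter_mono nhdsWithin_le_nhds
  filter_upwards [h1, h2, eventually_mem_nhdsWithin] with c hcδ hc0 hca hcs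
  refine hgap (c * c - a * c) ?_ hcδ ?_
  · rw [← sub_mul]
    exact mul_ne_zero (sub_ne_zero.2 hca) hc0
  · have h3 := spectrum.subset_polynomial_aeval x
      (Polynomial.X * Polynomial.X - Polynomial.C a * Polynomial.X : Polynomial ℝ) ⟨c, hcs, rfl⟩
    simpa [Algebra.smul_def] using h3

section Operators

variable {H : Type*} [NormedAddCommGroup H] [InnerProductSpace ℂ H] [CompleteSpace H]

theorem eq_zero_of_star_mul_self_add {B : Type*} [CStarAlgebra B] [PartialOrder B]
    [StarOrderedRing B] {x y : B} (h : star x * x + star y * y = 0) : x = 0 := by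
  rw [add_eq_zero_iff_of_nonneg (star_mul_self_nonneg x) (star_mul_self_nonneg y)] at h
  exact (CStarRing.star_mul_self_eq_zero_iff x).1 h.1

theorem real_smul_mem (A : NonUnitalStarSubalgebra ℂ (H →L[ℂ] H)) (c : ℝ) {x : H →L[ℂ] H}
    (hx : x ∈ A) : c • x ∈ A := by
  rw [← Complex.coe_smul]
  exact SMulMemClass.smul_mem _ hx

/-- A polynomial without constant term maps an algebra without unit into itself. -/
theorem aeval_mem_of_eval_zero (A : NonUnitalStarSubalgebra ℂ (H →L[ℂ] H)) {x : H →L[ℂ] H}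
    (hx : x ∈ A) (P : Polynomial ℝ) (hP : P.eval 0 = 0) : Polynomial.aeval x P ∈ A := by
  obtain ⟨Q, rfl⟩ := (Polynomial.X_dvd_iff (f := P)).2 (by rwa [Polynomial.coeff_zero_eq_eval_zero])
  rw [map_mul, Polynomial.aeval_X]
  clear hP
  induction Q using Polynomial.induction_on' with
  | add p q hp hq =>
    rw [map_add, mul_add]
    exact A.add_mem hp hq
  | monomial n a =>
    rw [Polynomial.aeval_monomial, ← Algebra.smul_def, mul_smul_comm, ← pow_succ']
    refine real_smul_mem A a ?_
    induction n with
    | zero => simpa using hx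
    | succ n ih =>
      rw [pow_succ]
      exact A.mul_mem ih hx

/-- The algebraic properties of R*-algebras. For self-adjoint `x`, all the elements `x² - a x` are
regular, whence the spectrum of `x` is finite; the spectral projections for nonzero eigenvalues are
polynomials in `x` without constant term. -/
theorem IsRStarAlgebra.isSpectralAlgebra {A : NonUnitalStarSubalgebra ℂ (H →L[ℂ] H)}
    (hA : IsRStarAlgebra A) : IsSpectralAlgebra A := by
  have hpos : ∀ x y : A, star x * x + star y * y = 0 → x = 0 := fun x y h =>
    Subtype.ext (eq_zero_of_star_mul_self_add (y := y.1) (congrArg Subtype.val h))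
  have hpos' : ∀ x : A, star x * x = 0 → x = 0 := fun x h => hpos x 0 (by simp [h])
  have hreg : ∀ x : A, ∃ y, x * y * x = x := fun x => by
    obtain ⟨y, hy, hxy⟩ := hA x x.2
    exact ⟨⟨y, hy⟩, Subtype.ext hxy⟩
  refine ⟨hpos, hreg, fun x hx => ?_⟩
  have hX : IsSelfAdjoint x.1 := congrArg Subtype.val hx
  have hfin : (spectrum ℝ x.1).Finite := by
    refine finite_spectrum_of_gap fun a => ?_
    have hyA : x.1 * x.1 - a • x.1 ∈ A := A.sub_mem (A.mul_mem x.2 x.2) (real_smul_mem A a x.2)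
    have hys : IsSelfAdjoint (x.1 * x.1 - a • x.1) :=
      .sub (by rw [IsSelfAdjoint, star_mul, hX.star_eq]) (.smul (.all a) hX)
    obtain ⟨e, w, he, hey, hew⟩ := exists_range_projection_of_regular hpos' hreg ⟨_, hyA⟩
    generalize x.1 * x.1 - a • x.1 = y at *
    have he1 : e.1 * e.1 = e.1 := congrArg Subtype.val he.mul_self
    have he2 : star e.1 = e.1 := congrArg Subtype.val he.star_eq
    have hey1 : e.1 * y = y := congrArg Subtype.val hey
    have hew1 : e.1 = y * w.1 := congrArg Subtype.val hew
    have hye1 : y * e.1 = y := by simpa [hys.star_eq, he2] using congrArg star hey1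
    have hwe1 : e.1 = star w.1 * y := by
      rw [← he2, hew1, star_mul, hys.star_eq]
    have hyg : y * (e.1 * w.1 * e.1) = e.1 := by
      rw [← mul_assoc, ← mul_assoc, hye1, ← hew1, he1]
    have hgy' : e.1 * star w.1 * e.1 * y = e.1 := by
      rw [mul_assoc, hey1, mul_assoc, ← hwe1, he1]
    have hg : e.1 * star w.1 * e.1 = e.1 * w.1 * e.1 := by
      calc e.1 * star w.1 * e.1 = e.1 * star w.1 * e.1 * (y * (e.1 * w.1 * e.1)) := by
            rw [hyg, mul_assoc _ e.1 e.1, he1]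
        _ = e.1 * w.1 * e.1 := by
            rw [← mul_assoc, hgy', ← mul_assoc, ← mul_assoc, he1]
    refine exists_gap_of_corner_inverse he1 hey1 hye1 hyg (hg ▸ hgy') ?_ ?_
    · rw [← mul_assoc, ← mul_assoc, he1]
    · rw [mul_assoc, he1]
  have hcont : ∀ f : ℝ → ℝ, ContinuousOn f (spectrum ℝ x.1) := fun f => hfin.continuousOn f
  let δ : ℝ → ℝ → ℝ := fun c t => if t = c then 1 else 0
  have hmem : ∀ c ≠ 0, cfc (δ c) x.1 ∈ A := by
    intro c hc
    let S : Finset ℝ := insert 0 hfin.toFinset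
    let P : Polynomial ℝ := Lagrange.interpolate S id (δ c)
    have hP : ∀ t ∈ S, P.eval t = δ c t := fun t ht =>
      Lagrange.eval_interpolate_at_node (δ c) Function.injective_id.injOn ht
    have h1 : cfc (δ c) x.1 = Polynomial.aeval x.1 P := by
      rw [← cfc_polynomial P x.1 hX]
      exact cfc_congr fun t ht => (hP t (Finset.mem_insert_of_mem (hfin.mem_toFinset.2 ht))).symm
    rw [h1]
    refine aeval_mem_of_eval_zero A x.2 P ?_
    rw [hP 0 (Finset.mem_insert_self _ _)]
    exact if_neg hc.symm
  let p : ℝ → A := fun c => if hc : c ≠ 0 then ⟨cfc (δ c) x.1, hmem c hc⟩ else 0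
  have hpc : ∀ c ≠ 0, (p c).1 = cfc (δ c) x.1 := fun c hc => by
    simp only [p, dif_pos hc]
  have hne : ∀ c ∈ hfin.toFinset.erase 0, c ≠ 0 := fun c hc => Finset.ne_of_mem_erase hc
  refine ⟨hfin.toFinset.erase 0, p, Finset.notMem_erase _ _, fun c hc => ⟨?_, ?_⟩,
    fun c hc d hd hcd => ?_, ?_⟩
  · refine Subtype.ext ?_
    change (p c).1 * (p c).1 = (p c).1
    rw [hpc c (hne c hc), ← cfc_mul (δ c) (δ c) x.1 (hcont _) (hcont _)]
    refine cfc_congr fun t _ => ?_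
    simp only [δ]
    split_ifs <;> simp
  · refine Subtype.ext ?_
    change star (p c).1 = (p c).1
    rw [hpc c (hne c hc)]
    exact cfc_predicate (δ c) x.1
  · refine Subtype.ext ?_
    change (p c).1 * (p d).1 = 0
    rw [hpc c (hne c hc), hpc d (hne d hd), ← cfc_mul (δ c) (δ d) x.1 (hcont _) (hcont _),
      ← cfc_const_zero ℝ x.1]
    refine cfc_congr fun t _ => ?_
    simp only [δ]
    split_ifs with h1 h2
    · exact absurd (h1.symm.trans h2) hcd
    all_goals simp
  · refine Subtype.ext ?_
    have h1 : x.1 = cfc (fun t => ∑ c ∈ hfin.toFinset.erase 0, c • δ c t) x.1 := by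
      conv_lhs => rw [← cfc_id ℝ x.1 hX]
      refine cfc_congr fun t ht => ?_
      simp only [id, δ, smul_eq_mul, mul_ite, mul_one, mul_zero, Finset.sum_ite_eq,
        Finset.mem_erase, hfin.mem_toFinset]
      by_cases ht0 : t = 0
      · simp [ht0]
      · simp [ht0, ht]
    rw [AddSubmonoidClass.coe_finsetSum]
    refine h1.trans ((congrArg (cfc · x.1) (by ext; simp)).trans
      (cfc_sum (fun c t => c • δ c t) x.1 (hfin.toFinset.erase 0) fun c _ => hcont _) |>.trans ?_)
    refine Finset.sum_congr rfl fun c hc => ?_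
    rw [cfc_smul c (δ c) x.1 (hcont _), ← hpc c (hne c hc)]
    exact (Complex.coe_smul c _).symm

end Operators

/-! ### The algebra of simple functions on the Stone space -/

section StoneIndicator

variable {S : Type*} [GeneralizedBooleanAlgebra S]

open Classical in
theorem isSimple_indicator (a : S) :
    (stoneField S).IsSimple fun I => if I ∈ stoneSet a then 1 else 0 := by
  refine ⟨(Set.toFinite {1, 0}).subset ?_, fun z hz => ?_⟩
  · rintro _ ⟨I, rfl⟩
    dsimp only
    split_ifs <;> simp
  · by_cases h1 : z = 1
    · refine ⟨a, ?_⟩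
      ext I
      simp [h1]
    · refine ⟨⊥, ?_⟩
      rw [stoneSet_bot]
      ext I
      simp only [Set.mem_empty_iff_false, Set.mem_preimage, Set.mem_singleton_iff, false_iff]
      split_ifs
      · exact fun h => h1 h.symm
      · exact fun h => hz h.symm

open Classical in
/-- The characteristic function of the compact open set of `a`. -/
noncomputable def stoneIndicator (a : S) : commRStarAlgebra S :=
  ⟨fun I => if I ∈ stoneSet a then 1 else 0, isSimple_indicator a⟩

theorem stoneIndicator_of_mem {a : S} {I : StonePoint S} (h : I ∈ stoneSet a) :
    (stoneIndicator a).1 I = 1 := if_pos h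

theorem stoneIndicator_of_notMem {a : S} {I : StonePoint S} (h : I ∉ stoneSet a) :
    (stoneIndicator a).1 I = 0 := if_neg h

theorem commRStarAlgebra_ext {f g : commRStarAlgebra S} (h : ∀ I, f.1 I = g.1 I) : f = g :=
  Subtype.ext (funext h)

theorem stoneIndicator_isProj (a : S) : IsStarProjection (stoneIndicator a) := by
  constructor
  · refine commRStarAlgebra_ext fun I => ?_
    change (stoneIndicator a).1 I * (stoneIndicator a).1 I = (stoneIndicator a).1 I
    by_cases h : I ∈ stoneSet a
    · simp [stoneIndicator_of_mem h]
    · simp [stoneIndicator_of_notMem h]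
  · refine commRStarAlgebra_ext fun I => ?_
    change star ((stoneIndicator a).1 I) = (stoneIndicator a).1 I
    by_cases h : I ∈ stoneSet a
    · simp [stoneIndicator_of_mem h]
    · simp [stoneIndicator_of_notMem h]

/-- Multiplication by a characteristic function leaves exactly the functions supported in its set
unchanged. -/
theorem stoneIndicator_mul_eq_iff (a : S) (f : commRStarAlgebra S) :
    stoneIndicator a * f = f ↔ {I | f.1 I ≠ 0} ⊆ stoneSet a := by
  constructor
  · intro h I hI
    by_contra hIa
    have h1 : (stoneIndicator a).1 I * f.1 I = f.1 I := congrFun (congrArg Subtype.val h) I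
    rw [stoneIndicator_of_notMem hIa, zero_mul] at h1
    exact hI h1.symm
  · intro h
    refine commRStarAlgebra_ext fun I => ?_
    change (stoneIndicator a).1 I * f.1 I = f.1 I
    by_cases hI : f.1 I = 0
    · rw [hI, mul_zero]
    · rw [stoneIndicator_of_mem (h hI), one_mul]

theorem support_stoneIndicator (a : S) : {I | (stoneIndicator a).1 I ≠ 0} = stoneSet a := by
  ext I
  by_cases h : I ∈ stoneSet a
  · simp [stoneIndicator_of_mem h, h]
  · simp [stoneIndicator_of_notMem h, h]

theorem exists_support (f : commRStarAlgebra S) : ∃ a : S, stoneSet a = {I | f.1 I ≠ 0} :=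
  f.2.support_mem

theorem commRStarAlgebra_mul_comm (f g : commRStarAlgebra S) : f * g = g * f :=
  Subtype.ext (mul_comm f.1 g.1)

theorem stoneSet_injective : Function.Injective (stoneSet : S → Set (StonePoint S)) :=
  fun a b h => le_antisymm ((stoneSet_subset_iff a b).1 h.le) ((stoneSet_subset_iff b a).1 h.ge)

/-- The projections of `R(S)` are the characteristic functions, so they form a copy of `S`. -/
noncomputable def stoneOrderIso (S : Type*) [GeneralizedBooleanAlgebra S] :
    S ≃o ProjectionLattice (commRStarAlgebra S) :=
  RelIso.ofSurjective (r := (· ≤ ·)) (s := (· ≤ ·))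
    (OrderEmbedding.ofMapLEIff (fun a => ProjectionLattice.of _ (stoneIndicator_isProj a)) (by
      intro a b
      rw [ProjectionLattice.le_iff, ProjectionLattice.val_of, ProjectionLattice.val_of,
        commRStarAlgebra_mul_comm, stoneIndicator_mul_eq_iff, support_stoneIndicator,
        stoneSet_subset_iff])) (by
    intro p
    obtain ⟨a, ha⟩ := exists_support p.val
    refine ⟨a, ProjectionLattice.val_injective (commRStarAlgebra_ext fun I => ?_)⟩
    change (stoneIndicator a).1 I = p.val.1 I
    have h1 : p.val.1 I * p.val.1 I = p.val.1 I :=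
      congrFun (congrArg Subtype.val p.isProj.mul_self) I
    by_cases hI : p.val.1 I = 0
    · rw [hI, stoneIndicator_of_notMem (by rw [ha]; exact not_not.2 hI)]
    · rw [stoneIndicator_of_mem (by rw [ha]; exact hI)]
      exact (mul_left_cancel₀ hI (h1.trans (mul_one _).symm)).symm)

/-- `R(S)` is spanned by the characteristic functions. -/
theorem commRStarAlgebra_eq_sum (f : commRStarAlgebra S) :
    ∃ (s : Finset ℂ) (a : ℂ → S), f = ∑ z ∈ s, z • stoneIndicator (a z) := by
  classical
  have h : ∀ z : ℂ, ∃ a : S, z ≠ 0 → stoneSet a = f.1 ⁻¹' {z} := fun z => by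
    by_cases hz : z = 0
    · exact ⟨⊥, fun h => absurd hz h⟩
    · obtain ⟨a, ha⟩ := f.2.2 z hz
      exact ⟨a, fun _ => ha⟩
  choose a ha using h
  refine ⟨f.2.1.toFinset, a, commRStarAlgebra_ext fun I => ?_⟩
  rw [AddSubmonoidClass.coe_finsetSum, Finset.sum_apply, Finset.sum_eq_single (f.1 I)]
  · change f.1 I = f.1 I * (stoneIndicator _).1 I
    by_cases hI : f.1 I = 0
    · rw [hI, zero_mul]
    · rw [stoneIndicator_of_mem (by rw [ha _ hI]; rfl), mul_one]
  · intro z _ hz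
    change z * (stoneIndicator _).1 I = 0
    by_cases hz0 : z = 0
    · rw [hz0, zero_mul]
    · rw [stoneIndicator_of_notMem (by rw [ha _ hz0]; exact hz.symm), mul_zero]
  · exact fun h => absurd (f.2.1.mem_toFinset.2 ⟨I, rfl⟩) h

end StoneIndicator

/-! ### Commutative spectral algebras are algebras of simple functions -/

namespace IsSpectralAlgebra

variable {A : Type*} [NonUnitalRing A] [StarRing A] [Module ℂ A] [IsScalarTower ℂ A A]
  [SMulCommClass ℂ A A] [StarModule ℂ A]

omit [IsScalarTower ℂ A A] [SMulCommClass ℂ A A] in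
theorem span_projections (hA : IsSpectralAlgebra A) (x : A) :
    x ∈ Submodule.span ℂ {p : A | IsStarProjection p} := by
  have h : ∀ x, IsSelfAdjoint x → x ∈ Submodule.span ℂ {p : A | IsStarProjection p} := by
    intro x hx
    obtain ⟨s, p, -, hp, -, rfl⟩ := hA.spectral x hx
    exact Submodule.sum_mem _ fun c hc => Submodule.smul_mem _ _ (Submodule.subset_span (hp c hc))
  rw [← realPart_add_I_smul_imaginaryPart x]
  exact Submodule.add_mem _ (h _ (realPart x).2) (Submodule.smul_mem _ _ (h _ (imaginaryPart x).2))

variable {S : Type*} [GeneralizedBooleanAlgebra S]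

omit [Module ℂ A] [IsScalarTower ℂ A A] [SMulCommClass ℂ A A] [StarModule ℂ A] in
theorem orderIso_inf (φ : S ≃o ProjectionLattice A) (hcomm : ∀ x y : A, x * y = y * x) (a b : S) :
    (φ (a ⊓ b)).val = (φ a).val * (φ b).val := by
  have hab : IsStarProjection ((φ a).val * (φ b).val) :=
    (φ a).isProj.mul (φ b).isProj (hcomm _ _)
  have h1 : ProjectionLattice.of _ hab ≤ φ (a ⊓ b) := by
    rw [← φ.symm_apply_le, le_inf_iff, φ.symm_apply_le, φ.symm_apply_le,
      ProjectionLattice.le_iff, ProjectionLattice.le_iff, ProjectionLattice.val_of]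
    refine ⟨?_, by rw [mul_assoc, (φ b).isProj.mul_self]⟩
    rw [hcomm (φ a).val, mul_assoc, (φ a).isProj.mul_self]
  have h2 : (φ (a ⊓ b)).val * (φ a).val = (φ (a ⊓ b)).val := φ.monotone inf_le_left
  have h3 : (φ (a ⊓ b)).val * (φ b).val = (φ (a ⊓ b)).val := φ.monotone inf_le_right
  have h4 : φ (a ⊓ b) ≤ ProjectionLattice.of _ hab := by
    rw [ProjectionLattice.le_iff, ProjectionLattice.val_of, ← mul_assoc, h2, h3]
  exact congrArg ProjectionLattice.val (le_antisymm h4 h1)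

/-- A commutative spectral algebra is isomorphic to the algebra of simple functions over its
projections. A prime ideal `I` of projections defines a character `χ`: on a suitable projection
outside `I`, the element `x` acts as the scalar `χ x`. -/
theorem exists_commutative_representation (hA : IsSpectralAlgebra A)
    (hcomm : ∀ x y : A, x * y = y * x) (φ : S ≃o ProjectionLattice A) :
    Nonempty (A ≃⋆ₐ[ℂ] commRStarAlgebra S) := by
  classical
  set P : S → A := fun a => (φ a).val with hPdef
  have hP : ∀ a, IsStarProjection (P a) := fun a => (φ a).isProj
  have hinf : ∀ a b, P (a ⊓ b) = P a * P b := orderIso_inf φ hcomm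
  have hbot : P ⊥ = 0 := by
    have h : φ ⊥ ≤ ProjectionLattice.of 0 (.zero A) := by
      rw [← φ.le_symm_apply]; exact bot_le
    rw [ProjectionLattice.le_iff, ProjectionLattice.val_of, mul_zero] at h
    exact h.symm
  have hne : ∀ a, a ≠ ⊥ → P a ≠ 0 := fun a ha h => ha (φ.injective
    (ProjectionLattice.val_injective (h.trans hbot.symm)))
  have hsurj : ∀ p, IsStarProjection p → ∃ a, P a = p := fun p hp =>
    ⟨φ.symm (.of p hp), by simp [hPdef]⟩
  have huniq : ∀ (I : StonePoint S) (c : A) (z w : ℂ) (a b : S), a ∉ I.1 → b ∉ I.1 →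
      c * P a = z • P a → c * P b = w • P b → z = w := by
    intro I c z w a b ha hb hz hw
    have hab : a ⊓ b ∉ I.1 := fun h => (I.2.mem_or_mem h).elim ha hb
    have h0 : P (a ⊓ b) ≠ 0 := hne _ fun h => hab (h ▸ I.1.bot_mem)
    have h1 : c * P (a ⊓ b) = z • P (a ⊓ b) := by
      rw [hinf, ← mul_assoc, hz, smul_mul_assoc]
    have h2 : c * P (a ⊓ b) = w • P (a ⊓ b) := by
      rw [inf_comm, hinf, ← mul_assoc, hw, smul_mul_assoc]
    have h3 : (z - w) • P (a ⊓ b) = 0 := by rw [sub_smul, ← h1, ← h2, sub_self]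
    exact sub_eq_zero.1 ((smul_eq_zero.1 h3).resolve_right h0)
  have hproj : ∀ (I : StonePoint S) (a : S), ∃ b ∉ I.1,
      P a * P b = (stoneIndicator a).1 I • P b := by
    intro I a
    by_cases ha : a ∈ I.1
    · obtain ⟨b, hb⟩ : ∃ b, b ∉ I.1 := by
        by_contra! h
        exact I.2.ne_top (Order.Ideal.ext (by ext b; simp [h b]))
      refine ⟨b \ a, fun h => hb ?_, ?_⟩
      · exact I.1.lower le_sdiff_sup (Order.Ideal.sup_mem h ha)
      · rw [← hinf, inf_sdiff_self_right, hbot, stoneIndicator_of_notMem (not_not.2 ha), zero_smul]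
    · exact ⟨a, ha, by rw [(hP a).mul_self, stoneIndicator_of_mem (I := I) ha, one_smul]⟩
  have hex : ∀ (I : StonePoint S) (c : A), ∃ z : ℂ, ∃ a ∉ I.1, c * P a = z • P a := by
    intro I c
    induction hA.span_projections c using Submodule.span_induction with
    | mem p hp =>
      obtain ⟨a, rfl⟩ := hsurj p hp
      exact ⟨_, hproj I a⟩
    | zero =>
      obtain ⟨b, hb, -⟩ := hproj I ⊥
      exact ⟨0, b, hb, by simp⟩
    | add x y _ _ hx hy =>
      obtain ⟨z, a, ha, hxa⟩ := hx
      obtain ⟨w, b, hb, hyb⟩ := hy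
      refine ⟨z + w, a ⊓ b, fun h => (I.2.mem_or_mem h).elim ha hb, ?_⟩
      rw [add_mul, add_smul]
      congr 1
      · rw [hinf, ← mul_assoc, hxa, smul_mul_assoc]
      · rw [inf_comm, hinf, ← mul_assoc, hyb, smul_mul_assoc]
    | smul k x _ hx =>
      obtain ⟨z, a, ha, hxa⟩ := hx
      exact ⟨k * z, a, ha, by rw [smul_mul_assoc, hxa, smul_smul]⟩
  choose χ a ha hχ using hex
  have heq : ∀ I c z b, b ∉ I.1 → c * P b = z • P b → χ I c = z := fun I c z b hb h =>
    huniq I c _ z _ b (ha I c) hb (hχ I c) h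
  have hadd : ∀ I x y, χ I (x + y) = χ I x + χ I y := fun I x y => by
    refine heq I _ _ (a I x ⊓ a I y) (fun h => (I.2.mem_or_mem h).elim (ha I x) (ha I y)) ?_
    rw [add_mul, add_smul]
    congr 1
    · rw [hinf, ← mul_assoc, hχ, smul_mul_assoc]
    · rw [inf_comm, hinf, ← mul_assoc, hχ, smul_mul_assoc]
  have hmul : ∀ I x y, χ I (x * y) = χ I x * χ I y := fun I x y => by
    refine heq I _ _ (a I x ⊓ a I y) (fun h => (I.2.mem_or_mem h).elim (ha I x) (ha I y)) ?_
    rw [inf_comm, hinf, mul_assoc, ← mul_assoc y, hχ, smul_mul_assoc, mul_smul_comm,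
      hcomm (P _), ← mul_assoc, hχ, smul_mul_assoc, smul_smul, mul_comm]
  have hsmul : ∀ I (k : ℂ) x, χ I (k • x) = k * χ I x := fun I k x =>
    heq I _ _ (a I x) (ha I x) (by rw [smul_mul_assoc, hχ, smul_smul])
  have hstar : ∀ I x, χ I (star x) = star (χ I x) := fun I x => by
    refine heq I _ _ (a I x) (ha I x) ?_
    have h := congrArg star (hχ I x)
    rwa [star_mul, star_smul, (hP _).star_eq, hcomm] at h
  have hzero : ∀ I, χ I 0 = 0 := fun I => by simpa using hsmul I 0 0
  have hχP : ∀ b, (fun I => χ I (P b)) = (stoneIndicator b).1 := fun b => by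
    funext I
    obtain ⟨d, hd, h⟩ := hproj I b
    exact heq I _ _ d hd h
  have hmem : ∀ x, (fun I => χ I x) ∈ commRStarAlgebra S := by
    intro x
    induction hA.span_projections x using Submodule.span_induction with
    | mem p hp =>
      obtain ⟨b, rfl⟩ := hsurj p hp
      rw [hχP]
      exact (stoneIndicator b).2
    | zero =>
      simp only [hzero]
      exact (commRStarAlgebra S).zero_mem
    | add x y _ _ hx hy =>
      simp only [hadd]
      exact (commRStarAlgebra S).add_mem hx hy
    | smul k x _ hx =>
      simp only [hsmul]
      exact SMulMemClass.smul_mem k hx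
  let Φ : A →⋆ₙₐ[ℂ] commRStarAlgebra S :=
    { toFun := fun x => ⟨fun I => χ I x, hmem x⟩
      map_smul' := fun k x => commRStarAlgebra_ext fun I => hsmul I k x
      map_zero' := commRStarAlgebra_ext hzero
      map_add' := fun x y => commRStarAlgebra_ext fun I => hadd I x y
      map_mul' := fun x y => commRStarAlgebra_ext fun I => hmul I x y
      map_star' := fun x => commRStarAlgebra_ext fun I => hstar I x }
  have hΦP : ∀ b, Φ (P b) = stoneIndicator b := fun b => Subtype.ext (hχP b)
  refine ⟨StarAlgEquiv.ofBijective Φ ⟨(injective_iff_map_eq_zero Φ).2 fun x hx => ?_, fun f => ?_⟩⟩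
  · -- a nonzero spectral value of `x⋆ x` is a value of the corresponding function
    have hxx : Φ (star x * x) = 0 := by rw [map_mul, hx, mul_zero]
    obtain ⟨s, p, h0, hp, ho, hs⟩ := hA.spectral (star x * x) (.star_mul_self x)
    refine hA.eq_zero_of_star_mul_self ?_
    rw [hs]
    refine Finset.sum_eq_zero fun c hc => ?_
    obtain ⟨b, hb⟩ := hsurj (p c) (hp c hc)
    have hc0 : (c : ℂ) ≠ 0 := by
      simp only [ne_eq, Complex.ofReal_eq_zero]
      exact fun h => h0 (h ▸ hc)
    have h1 : (c : ℂ) • stoneIndicator b = 0 := by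
      rw [← hΦP, ← map_smul, hb, ← spectral_mul hp ho hc, ← hs, map_mul, hxx, zero_mul]
    have h2 : stoneIndicator b = 0 := (smul_eq_zero.1 h1).resolve_left hc0
    have h3 : b = ⊥ := by
      refine stoneSet_injective ?_
      rw [stoneSet_bot, ← support_stoneIndicator, h2]
      ext I
      simp
    rw [← hb, h3, hbot, smul_zero]
  · obtain ⟨s, b, rfl⟩ := commRStarAlgebra_eq_sum f
    refine ⟨∑ z ∈ s, z • P (b z), ?_⟩
    simp only [map_sum, map_smul, hΦP]

end IsSpectralAlgebra

/-! ### Projections of a commutative algebra -/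

section CommProjections

/-- To verify a ring identity in a commutative ring without unit, adjoin a unit. -/
theorem eq_of_inr_eq {A : Type*} [NonUnitalCommRing A] {x y : A} (h : (x : Unitization ℤ A) = y) : x = y :=
  Unitization.inr_injective h

variable {A : Type*} [NonUnitalCommRing A] [StarRing A]

theorem ProjectionLattice.inr_mul_self (p : ProjectionLattice A) :
    (p.val : Unitization ℤ A) * p.val = p.val := by
  rw [← Unitization.inr_mul, p.isProj.mul_self]

theorem ProjectionLattice.le_iff_inr {p q : ProjectionLattice A} :
    p ≤ q ↔ (p.val : Unitization ℤ A) * q.val = p.val := by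
  rw [ProjectionLattice.le_iff, ← Unitization.inr_mul, Unitization.inr_injective.eq_iff]

open ProjectionLattice in
/-- The projections of a commutative algebra form a generalized Boolean algebra under the usual
order, with `p ⊓ q = p q`, `p ⊔ q = p + q - p q` and `p \ q = p - p q`. -/
@[reducible]
def projectionGeneralizedBooleanAlgebra (A : Type*) [NonUnitalCommRing A] [StarRing A] :
    GeneralizedBooleanAlgebra (ProjectionLattice A) where
  __ := ProjectionLattice.instPartialOrder A
  sup p q := of (p.val + q.val - p.val * q.val)
    (p.isProj.add_sub_mul_of_commute (Commute.all _ _) q.isProj)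
  inf p q := of (p.val * q.val) (p.isProj.mul q.isProj (Commute.all _ _))
  sdiff p q := of (p.val - p.val * q.val)
    ((p.isProj.mul q.isProj (Commute.all _ _)).sub_of_mul_eq_right p.isProj (by
      rw [← mul_assoc, p.isProj.mul_self]))
  bot := of 0 (.zero A)
  le_sup_left p q := by
    rw [le_iff_inr]
    simp only [val_of, Unitization.inr_add, Unitization.inr_sub, Unitization.inr_mul]
    linear_combination (1 - (q.val : Unitization ℤ A)) * p.inr_mul_self
  le_sup_right p q := by
    rw [le_iff_inr]
    simp only [val_of, Unitization.inr_add, Unitization.inr_sub, Unitization.inr_mul]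
    linear_combination (1 - (p.val : Unitization ℤ A)) * q.inr_mul_self
  sup_le p q r hp hq := by
    rw [le_iff_inr] at hp hq ⊢
    simp only [val_of, Unitization.inr_add, Unitization.inr_sub, Unitization.inr_mul]
    linear_combination hp + (1 - (p.val : Unitization ℤ A)) * hq
  inf_le_left p q := by
    rw [le_iff_inr]
    simp only [val_of, Unitization.inr_mul]
    linear_combination (q.val : Unitization ℤ A) * p.inr_mul_self
  inf_le_right p q := by
    rw [le_iff_inr]
    simp only [val_of, Unitization.inr_mul]
    linear_combination (p.val : Unitization ℤ A) * q.inr_mul_self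
  le_inf p q r hq hr := by
    rw [le_iff_inr] at hq hr ⊢
    simp only [val_of, Unitization.inr_mul]
    linear_combination (r.val : Unitization ℤ A) * hq + hr
  le_sup_inf p q r := by
    refine eq_of_inr_eq ?_
    change (((p.val + q.val - p.val * q.val) * (p.val + r.val - p.val * r.val) *
      (p.val + q.val * r.val - p.val * (q.val * r.val)) : A) : Unitization ℤ A) =
      ((p.val + q.val - p.val * q.val) * (p.val + r.val - p.val * r.val) : A)
    simp only [Unitization.inr_add, Unitization.inr_sub, Unitization.inr_mul]
    have hp := p.inr_mul_self
    have hq := q.inr_mul_self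
    have hr := r.inr_mul_self
    generalize (p.val : Unitization ℤ A) = a at *
    generalize (q.val : Unitization ℤ A) = b at *
    generalize (r.val : Unitization ℤ A) = c at *
    have h1 : (a + b - a * b) * (a + c - a * c) = a + b * c - a * (b * c) := by
      linear_combination (1 - b - c + b * c) * hp
    have h2 : (a + b * c - a * (b * c)) * (a + b * c - a * (b * c)) =
        a + b * c - a * (b * c) := by
      have h3 : b * c * (b * c) = b * c := by
        linear_combination c * c * hq + b * hr
      linear_combination (1 - b * c) * (1 - b * c) * hp + (1 - a) * h3
    rw [h1, h2]
  sup_inf_sdiff p q := by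
    refine val_injective (eq_of_inr_eq ?_)
    change ((p.val * q.val + (p.val - p.val * q.val) -
      p.val * q.val * (p.val - p.val * q.val) : A) : Unitization ℤ A) = p.val
    simp only [Unitization.inr_add, Unitization.inr_sub, Unitization.inr_mul]
    linear_combination (p.val : Unitization ℤ A) * p.val * q.inr_mul_self
  inf_inf_sdiff p q := by
    refine val_injective (eq_of_inr_eq ?_)
    change ((p.val * q.val * (p.val - p.val * q.val) : A) : Unitization ℤ A) = (0 : A)
    simp only [Unitization.inr_sub, Unitization.inr_mul, Unitization.inr_zero]
    linear_combination (-(p.val : Unitization ℤ A)) * p.val * q.inr_mul_self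

end CommProjections

/-- A generalized Boolean algebra with arbitrary suprema is a complete Boolean algebra. -/
@[reducible]
noncomputable def completeBooleanAlgebraOfIsLUB {S : Type*} [GeneralizedBooleanAlgebra S]
    (h : ∀ s : Set S, ∃ b, IsLUB s b) : CompleteBooleanAlgebra S :=
  letI : OrderTop S :=
    { top := (h Set.univ).choose
      le_top := fun a => (h Set.univ).choose_spec.1 (Set.mem_univ a) }
  { GeneralizedBooleanAlgebra.toBooleanAlgebra (α := S) with
    sSup := fun s => (h s).choose
    sInf := fun s => (h (lowerBounds s)).choose
    isLUB_sSup := fun s => (h s).choose_spec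
    isGLB_sInf := fun s => isLUB_lowerBounds.1 (h (lowerBounds s)).choose_spec }

/-- The projections of a commutative algebra are a generalized Boolean algebra. -/
theorem exists_generalizedBooleanAlgebra {C : Type u} [R : NonUnitalRing C] [StarRing C]
    (hcomm : ∀ x y : C, x * y = y * x) :
    ∃ (S : Type u) (_ : GeneralizedBooleanAlgebra S), Nonempty (S ≃o ProjectionLattice C) := by
  let i : NonUnitalCommRing C := { R with mul_comm := hcomm }
  exact ⟨ProjectionLattice C, projectionGeneralizedBooleanAlgebra C, ⟨OrderIso.refl _⟩⟩

/-- If all suprema of projections of a commutative algebra exist, then the projections are a complete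
Boolean algebra. -/
theorem exists_completeBooleanAlgebra {C : Type u} [NonUnitalRing C] [StarRing C]
    (hcomm : ∀ x y : C, x * y = y * x) (h : ∀ s : Set (ProjectionLattice C), ∃ b, IsLUB s b) :
    ∃ (S : Type u) (_ : CompleteBooleanAlgebra S), Nonempty (S ≃o ProjectionLattice C) := by
  obtain ⟨S, _, ⟨φ⟩⟩ := exists_generalizedBooleanAlgebra hcomm
  have hS : ∀ s : Set S, ∃ b, IsLUB s b := fun s => by
    obtain ⟨b, hb⟩ := h (φ '' s)
    exact ⟨φ.symm b, by rwa [← φ.isLUB_image]⟩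
  exact ⟨S, completeBooleanAlgebraOfIsLUB hS, ⟨φ⟩⟩

/-! ### Baer rings -/

theorem IsBaerRing.of_ringEquiv {R R' : Type*} [NonUnitalRing R] [NonUnitalRing R']
    (f : R ≃+* R') (hR : IsBaerRing R') : IsBaerRing R := by
  intro X
  obtain ⟨e, he, hX⟩ := hR (f '' X)
  refine ⟨f.symm e, he.map f.symm, ?_⟩
  ext r
  have h := Set.ext_iff.1 hX (f r)
  simp only [Set.mem_ofPred_eq, Set.forall_mem_image, ← map_mul, map_eq_zero_iff f f.injective,
    Set.mem_range] at h ⊢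
  rw [h]
  constructor
  · rintro ⟨y, hy⟩
    exact ⟨f.symm y, by rw [← map_mul, hy, f.symm_apply_apply]⟩
  · rintro ⟨y, rfl⟩
    exact ⟨f y, by rw [map_mul, f.apply_symm_apply]⟩

theorem IsBaerRing.prod {R R' : Type*} [NonUnitalRing R] [NonUnitalRing R']
    (hR : IsBaerRing R) (hR' : IsBaerRing R') : IsBaerRing (R × R') := by
  intro X
  obtain ⟨e, he, hX⟩ := hR (Prod.fst '' X)
  obtain ⟨e', he', hX'⟩ := hR' (Prod.snd '' X)
  refine ⟨(e, e'), Prod.ext he he', ?_⟩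
  ext r
  have h := Set.ext_iff.1 hX r.1
  have h' := Set.ext_iff.1 hX' r.2
  simp only [Set.mem_ofPred_eq, Set.forall_mem_image, Set.mem_range] at h h' ⊢
  constructor
  · intro hr
    obtain ⟨y, hy⟩ := h.1 fun x hx => congrArg Prod.fst (hr x hx)
    obtain ⟨y', hy'⟩ := h'.1 fun x hx => congrArg Prod.snd (hr x hx)
    exact ⟨(y, y'), Prod.ext hy hy'⟩
  · rintro ⟨y, rfl⟩ x hx
    exact Prod.ext (h.2 ⟨y.1, rfl⟩ hx) (h'.2 ⟨y.2, rfl⟩ hx)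

theorem IsBaerRing.of_starAlgEquiv_prod {A R R' : Type*} [NonUnitalRing A] [StarRing A]
    [Module ℂ A] [NonUnitalRing R] [StarRing R] [Module ℂ R] [NonUnitalRing R'] [StarRing R']
    [Module ℂ R'] (f : A ≃⋆ₐ[ℂ] (R × R')) (hR : IsBaerRing R) (hR' : IsBaerRing R') :
    IsBaerRing A :=
  (hR.prod hR').of_ringEquiv f.toRingEquiv

/-- The annihilator of a set of simple functions consists of the functions supported in the
complement of the supremum of the supports. -/
theorem isBaerRing_commRStarAlgebra (S : Type*) [CompleteBooleanAlgebra S] :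
    IsBaerRing (commRStarAlgebra S) := by
  intro X
  have hsupp : ∀ x : commRStarAlgebra S, ∃ a : S, stoneSet a = {I | x.1 I ≠ 0} := exists_support
  choose a ha using hsupp
  have hann : ∀ x r : commRStarAlgebra S, x * r = 0 ↔ a r ≤ (a x)ᶜ := by
    intro x r
    rw [le_compl_iff_disjoint_left, disjoint_iff, ← (stoneSet_injective (S := S)).eq_iff, stoneSet_inf,
      stoneSet_bot, ha, ha]
    constructor
    · intro h
      ext I
      have h1 : x.1 I * r.1 I = 0 := congrFun (congrArg Subtype.val h) I
      rcases mul_eq_zero.1 h1 with h2 | h2 <;> simp [h2]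
    · intro h
      refine commRStarAlgebra_ext fun I => ?_
      change x.1 I * r.1 I = 0
      by_contra hI
      have h1 : I ∈ ({I | x.1 I ≠ 0} ∩ {I | r.1 I ≠ 0} : Set (StonePoint S)) :=
        mul_ne_zero_iff.1 hI
      rw [h] at h1
      exact h1
  refine ⟨stoneIndicator (⨅ x ∈ X, (a x)ᶜ), (stoneIndicator_isProj _).isIdempotentElem, ?_⟩
  ext r
  have h1 : (∀ x ∈ X, x * r = 0) ↔ stoneIndicator (⨅ x ∈ X, (a x)ᶜ) * r = r := by
    rw [stoneIndicator_mul_eq_iff, ← ha, stoneSet_subset_iff, le_iInf₂_iff]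
    simp only [hann]
  rw [Set.mem_ofPred_eq, h1]
  constructor
  · exact fun h => ⟨r, h⟩
  · rintro ⟨y, rfl⟩
    dsimp only
    rw [← mul_assoc, (stoneIndicator_isProj _).mul_self]

namespace IsSpectralAlgebra

variable {A : Type*} [NonUnitalRing A] [StarRing A] [Module ℂ A]

theorem _root_.IsBaerRing.exists_unit {A : Type*} [NonUnitalRing A] [StarRing A]
    (hB : IsBaerRing A) : ∃ u : A, IsStarProjection u ∧ (∀ a, u * a = a) ∧ ∀ a, a * u = a := by
  obtain ⟨e, he, hX⟩ := hB ∅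
  have hl : ∀ a, e * a = a := fun a => by
    have h : a ∈ Set.range (fun r : A => e * r) := by
      rw [← hX]; simp
    obtain ⟨r, rfl⟩ := h
    dsimp only
    rw [← mul_assoc, he.eq]
  have hr : ∀ a, a * star e = a := fun a => by
    simpa using congrArg star (hl (star a))
  have hs : star e = e := by rw [← hl (star e), hr]
  exact ⟨e, ⟨he, hs⟩, hl, fun a => by rw [← hs, hr]⟩

/-- In a Baer ring all families of projections have suprema: the annihilator of the family is
generated by a projection, whose complement is the supremum. -/
theorem exists_isLUB_of_isBaerRing (hA : IsSpectralAlgebra A) (hB : IsBaerRing A)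
    (s : Set (ProjectionLattice A)) : ∃ b, IsLUB s b := by
  obtain ⟨u, hu, hul, hur⟩ := hB.exists_unit
  obtain ⟨e, he, hX⟩ := hB (ProjectionLattice.val '' s)
  obtain ⟨f, w, hf, hfe, hfw⟩ := hA.exists_range_projection e
  have hann : ∀ r, (∀ q ∈ s, q.val * r = 0) ↔ f * r = r := by
    intro r
    have h := Set.ext_iff.1 hX r
    simp only [Set.mem_ofPred_eq, Set.forall_mem_image, Set.mem_range] at h
    rw [h]
    constructor
    · rintro ⟨y, rfl⟩
      rw [← mul_assoc, hfe]
    · intro hr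
      exact ⟨w * r, by rw [← mul_assoc, ← hfw, hr]⟩
  refine ⟨.of (u - f) (hf.sub_of_mul_eq_left hu (hur f)), fun q hq => ?_, fun c hc => ?_⟩
  · rw [ProjectionLattice.le_iff, ProjectionLattice.val_of, mul_sub, hur,
      (hann f).2 hf.mul_self q hq, sub_zero]
  · have h1 : f * (u - c.val) = u - c.val := by
      rw [← hann]
      intro q hq
      have h2 : q.val * c.val = q.val := hc hq
      rw [mul_sub, hur, h2, sub_self]
    rw [ProjectionLattice.le_iff, ProjectionLattice.val_of, sub_mul, hul]
    rw [mul_sub, hur] at h1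
    have h3 : f * c.val = f - (u - c.val) := by
      rw [← h1, sub_sub_cancel]
    rw [h3]
    abel

variable [SMulCommClass ℂ A A]

/-- A right annihilator in a finite-dimensional algebra is generated by a projection in it of
maximal rank. -/
theorem isBaerRing_of_finiteDimensional (hA : IsSpectralAlgebra A) [FiniteDimensional ℂ A] :
    IsBaerRing A := by
  intro X
  let T : Set A := {e | IsStarProjection e ∧ ∀ x ∈ X, x * e = 0}
  let d : A → ℕ := fun e => Module.finrank ℂ (LinearMap.range (LinearMap.mulLeft ℂ e))
  obtain ⟨e, ⟨he, heX⟩, hmax⟩ := (measure fun e => Module.finrank ℂ A - d e).wf.has_min T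
    ⟨0, .zero A, fun x _ => mul_zero x⟩
  refine ⟨e, he.isIdempotentElem, ?_⟩
  ext r
  simp only [Set.mem_ofPred_eq, Set.mem_range]
  constructor
  · intro hr
    refine ⟨r, ?_⟩
    by_contra hne
    obtain ⟨f, w, hf, hfr, hfw⟩ := hA.exists_range_projection (r - e * r)
    have hef : e * f = 0 := by
      rw [hfw, ← mul_assoc, mul_sub, ← mul_assoc, he.mul_self, sub_self, zero_mul]
    have hfe : f * e = 0 := he.mul_eq_zero_comm hf hef
    have hf0 : f ≠ 0 := by
      rintro rfl
      rw [zero_mul] at hfr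
      exact hne (sub_eq_zero.1 hfr.symm).symm
    have hXf : ∀ x ∈ X, x * f = 0 := fun x hx => by
      rw [hfw, ← mul_assoc, mul_sub, hr x hx, ← mul_assoc, heX x hx, zero_mul, sub_self, zero_mul]
    refine hmax (e + f) ⟨he.add hf hef, fun x hx => by rw [mul_add, heX x hx, hXf x hx, add_zero]⟩
      ?_
    have hlt : LinearMap.range (LinearMap.mulLeft ℂ e) <
        LinearMap.range (LinearMap.mulLeft ℂ (e + f)) := by
      refine SetLike.lt_iff_le_and_exists.2 ⟨?_, f, LinearMap.mem_range.2 ⟨f, ?_⟩, fun hmem => ?_⟩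
      · rintro _ ⟨y, rfl⟩
        refine ⟨e * y, ?_⟩
        rw [LinearMap.mulLeft_apply, LinearMap.mulLeft_apply, add_mul, ← mul_assoc, ← mul_assoc,
          he.mul_self, hfe, zero_mul, add_zero]
      · rw [LinearMap.mulLeft_apply, add_mul, hef, hf.mul_self, zero_add]
      · obtain ⟨y, hy⟩ := LinearMap.mem_range.1 hmem
        rw [LinearMap.mulLeft_apply] at hy
        apply hf0
        rw [← hf.mul_self]
        nth_rw 2 [← hy]
        rw [← mul_assoc, hfe, zero_mul]
    have h1 : d e < d (e + f) := Submodule.finrank_lt_finrank_of_lt hlt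
    have h2 : d (e + f) ≤ Module.finrank ℂ A := Submodule.finrank_le _
    change Module.finrank ℂ A - d (e + f) < Module.finrank ℂ A - d e
    omega
  · rintro ⟨y, rfl⟩ x hx
    rw [← mul_assoc, heX x hx, zero_mul]

end IsSpectralAlgebra

/-! ### Suprema under isomorphisms and products -/

theorem IsUpwardSigmaComplete.of_orderIso {P Q : Type*} [PartialOrder P] [PartialOrder Q]
    (f : P ≃o Q) (hQ : IsUpwardSigmaComplete Q) : IsUpwardSigmaComplete P := by
  intro s hs hsc
  obtain ⟨b, hb⟩ := hQ (f '' s) (hs.image f) (hsc.image f)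
  exact ⟨f.symm b, by rwa [← f.isLUB_image]⟩

theorem IsSigmaComplete.of_orderIso {P Q : Type*} [PartialOrder P] [PartialOrder Q]
    (f : P ≃o Q) (hQ : IsSigmaComplete Q) : IsSigmaComplete P := by
  refine ⟨hQ.1.of_orderIso f, fun s hs hsc => ?_⟩
  obtain ⟨b, hb⟩ := hQ.2 (f '' s) (hs.image f) (hsc.image f)
  exact ⟨f.symm b, by rwa [← f.isGLB_image]⟩

/-- The order isomorphism of projection lattices induced by a `*`-isomorphism. -/
def projectionOrderIso {A B : Type*} [NonUnitalRing A] [StarRing A] [NonUnitalRing B] [StarRing B]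
    [SMul ℂ A] [SMul ℂ B] (f : A ≃⋆ₐ[ℂ] B) : ProjectionLattice A ≃o ProjectionLattice B where
  toFun p := .of (f p.val) (p.isProj.map f)
  invFun p := .of (f.symm p.val) (p.isProj.map f.symm)
  left_inv p := ProjectionLattice.val_injective (f.symm_apply_apply _)
  right_inv p := ProjectionLattice.val_injective (f.apply_symm_apply _)
  map_rel_iff' := by
    intro p q
    change f p.val * f q.val = f p.val ↔ p.val * q.val = p.val
    rw [← map_mul, (EquivLike.injective f).eq_iff]

theorem isUpwardSigmaComplete_prod {A B : Type*} [NonUnitalRing A] [StarRing A] [NonUnitalRing B]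
    [StarRing B] (hA : IsUpwardSigmaComplete (ProjectionLattice A))
    (hB : IsUpwardSigmaComplete (ProjectionLattice B)) :
    IsUpwardSigmaComplete (ProjectionLattice (A × B)) := by
  let π₁ : ProjectionLattice (A × B) → ProjectionLattice A := fun p =>
    .of p.val.1 ⟨congrArg Prod.fst p.isProj.mul_self, congrArg Prod.fst p.isProj.star_eq⟩
  let π₂ : ProjectionLattice (A × B) → ProjectionLattice B := fun p =>
    .of p.val.2 ⟨congrArg Prod.snd p.isProj.mul_self, congrArg Prod.snd p.isProj.star_eq⟩
  have hle : ∀ p q, p ≤ q ↔ π₁ p ≤ π₁ q ∧ π₂ p ≤ π₂ q := fun p q => Prod.ext_iff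
  intro s hs hsc
  obtain ⟨b₁, hb₁⟩ := hA (π₁ '' s) (hs.image _) (hsc.image _)
  obtain ⟨b₂, hb₂⟩ := hB (π₂ '' s) (hs.image _) (hsc.image _)
  refine ⟨.of (b₁.val, b₂.val) ⟨Prod.ext b₁.isProj.mul_self b₂.isProj.mul_self,
    Prod.ext b₁.isProj.star_eq b₂.isProj.star_eq⟩, fun p hp => (hle _ _).2 ⟨hb₁.1 ⟨p, hp, rfl⟩,
    hb₂.1 ⟨p, hp, rfl⟩⟩, fun c hc => (hle _ _).2 ⟨hb₁.2 ?_, hb₂.2 ?_⟩⟩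
  · rintro _ ⟨p, hp, rfl⟩
    exact ((hle _ _).1 (hc hp)).1
  · rintro _ ⟨p, hp, rfl⟩
    exact ((hle _ _).1 (hc hp)).2

/-! ### Splitting an R*-algebra along a central projection -/

section Split

variable {H : Type*} [NormedAddCommGroup H] [InnerProductSpace ℂ H] [CompleteSpace H]
  (A : NonUnitalStarSubalgebra ℂ (H →L[ℂ] H)) (e : A) (he : IsStarProjection e)
  (hcen : ∀ a : A, e * a = a * e)

/-- The direct summand `e A` of `A`, for a central projection `e`, as an algebra of operators. -/
def centralCorner : NonUnitalStarSubalgebra ℂ (H →L[ℂ] H) where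
  carrier := {x | x ∈ A ∧ e.1 * x = x}
  add_mem' hx hy := ⟨A.add_mem hx.1 hy.1, by rw [mul_add, hx.2, hy.2]⟩
  zero_mem' := ⟨A.zero_mem, mul_zero _⟩
  mul_mem' hx hy := ⟨A.mul_mem hx.1 hy.1, by rw [← mul_assoc, hx.2]⟩
  smul_mem' c x hx := ⟨SMulMemClass.smul_mem c hx.1, by rw [mul_smul_comm, hx.2]⟩
  star_mem' {x} hx := ⟨star_mem hx.1, by
    have h1 : e.1 * x = x * e.1 := congrArg Subtype.val (hcen ⟨x, hx.1⟩)
    have h2 := congrArg star (h1.symm.trans hx.2)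
    rwa [star_mul, show star e.1 = e.1 from congrArg Subtype.val he.star_eq] at h2⟩

/-- The direct summand `(1 - e) A` of `A`, for a central projection `e`, as an algebra of
operators. -/
def centralComplement : NonUnitalStarSubalgebra ℂ (H →L[ℂ] H) where
  carrier := {x | x ∈ A ∧ e.1 * x = 0}
  add_mem' hx hy := ⟨A.add_mem hx.1 hy.1, by rw [mul_add, hx.2, hy.2, add_zero]⟩
  zero_mem' := ⟨A.zero_mem, mul_zero _⟩
  mul_mem' hx hy := ⟨A.mul_mem hx.1 hy.1, by rw [← mul_assoc, hx.2, zero_mul]⟩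
  smul_mem' c x hx := ⟨SMulMemClass.smul_mem c hx.1, by rw [mul_smul_comm, hx.2, smul_zero]⟩
  star_mem' {x} hx := ⟨star_mem hx.1, by
    have h1 : e.1 * x = x * e.1 := congrArg Subtype.val (hcen ⟨x, hx.1⟩)
    have h2 := congrArg star (h1.symm.trans hx.2)
    rwa [star_mul, star_zero, show star e.1 = e.1 from congrArg Subtype.val he.star_eq] at h2⟩

variable {A}

theorem isRStarAlgebra_centralCorner (hA : IsRStarAlgebra A) :
    IsRStarAlgebra (centralCorner A e he hcen) := by
  rintro x ⟨hx, hex⟩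
  obtain ⟨y, hy, hxy⟩ := hA x hx
  have he1 : e.1 * e.1 = e.1 := congrArg Subtype.val he.mul_self
  have h1 : e.1 * x = x * e.1 := congrArg Subtype.val (hcen ⟨x, hx⟩)
  refine ⟨e.1 * y, ⟨A.mul_mem e.2 hy, by rw [← mul_assoc, he1]⟩, ?_⟩
  rw [← mul_assoc, ← h1, hex, hxy]

theorem isRStarAlgebra_centralComplement (hA : IsRStarAlgebra A) :
    IsRStarAlgebra (centralComplement A e he hcen) := by
  rintro x ⟨hx, hex⟩
  obtain ⟨y, hy, hxy⟩ := hA x hx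
  have he1 : e.1 * e.1 = e.1 := congrArg Subtype.val he.mul_self
  have h1 : e.1 * x = x * e.1 := congrArg Subtype.val (hcen ⟨x, hx⟩)
  refine ⟨y - e.1 * y, ⟨A.sub_mem hy (A.mul_mem e.2 hy), by
    rw [mul_sub, ← mul_assoc, he1, sub_self]⟩, ?_⟩
  rw [mul_sub, ← mul_assoc, ← h1, hex, zero_mul, sub_zero, hxy]

/-- A central projection splits the algebra into a direct sum. -/
def centralSplitting :
    A ≃⋆ₐ[ℂ] (centralComplement A e he hcen × centralCorner A e he hcen) where
  toFun a := (⟨a.1 - e.1 * a.1, A.sub_mem a.2 (A.mul_mem e.2 a.2), by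
      rw [mul_sub, ← mul_assoc, show e.1 * e.1 = e.1 from congrArg Subtype.val he.mul_self,
        sub_self]⟩,
    ⟨e.1 * a.1, A.mul_mem e.2 a.2, by
      rw [← mul_assoc, show e.1 * e.1 = e.1 from congrArg Subtype.val he.mul_self]⟩)
  invFun b := ⟨b.1.1 + b.2.1, A.add_mem b.1.2.1 b.2.2.1⟩
  left_inv a := Subtype.ext (sub_add_cancel _ _)
  right_inv b := by
    have h1 : e.1 * (b.1.1 + b.2.1) = b.2.1 := by
      rw [mul_add, b.1.2.2, b.2.2.2, zero_add]
    refine Prod.ext (Subtype.ext ?_) (Subtype.ext h1)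
    change b.1.1 + b.2.1 - e.1 * (b.1.1 + b.2.1) = b.1.1
    rw [h1, add_sub_cancel_right]
  map_add' a b := by
    refine Prod.ext (Subtype.ext ?_) (Subtype.ext (mul_add _ _ _))
    change a.1 + b.1 - e.1 * (a.1 + b.1) = a.1 - e.1 * a.1 + (b.1 - e.1 * b.1)
    rw [mul_add]
    abel
  map_mul' a b := by
    have he1 : e.1 * e.1 = e.1 := congrArg Subtype.val he.mul_self
    have h1 : e.1 * a.1 = a.1 * e.1 := congrArg Subtype.val (hcen a)
    have h2 : e.1 * a.1 * (e.1 * b.1) = e.1 * (a.1 * b.1) := by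
      rw [h1, mul_assoc, ← mul_assoc e.1, he1, ← mul_assoc, ← h1, mul_assoc]
    refine Prod.ext (Subtype.ext ?_) (Subtype.ext h2.symm)
    change a.1 * b.1 - e.1 * (a.1 * b.1) = (a.1 - e.1 * a.1) * (b.1 - e.1 * b.1)
    rw [sub_mul, mul_sub, mul_sub, h2, mul_assoc e.1, sub_self, sub_zero, ← mul_assoc a.1, ← h1,
      mul_assoc]
  map_smul' c a := by
    refine Prod.ext (Subtype.ext ?_) (Subtype.ext (mul_smul_comm _ _ _))
    change c • a.1 - e.1 * (c • a.1) = c • (a.1 - e.1 * a.1)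
    rw [mul_smul_comm, smul_sub]
  map_star' a := by
    have h1 : e.1 * star a.1 = star (e.1 * a.1) := by
      rw [star_mul, show star e.1 = e.1 from congrArg Subtype.val he.star_eq]
      exact congrArg Subtype.val (hcen (star a))
    refine Prod.ext (Subtype.ext ?_) (Subtype.ext h1)
    change star a.1 - e.1 * star a.1 = star (a.1 - e.1 * a.1)
    rw [h1, star_sub]

/-- The projection of `A` underlying a projection of the complementary summand. -/
noncomputable def complementProjection (p : ProjectionLattice (centralComplement A e he hcen)) :
    ProjectionLattice A :=
  .of ⟨p.val.1, p.val.2.1⟩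
    ⟨Subtype.ext (show p.val.1 * p.val.1 = p.val.1 from congrArg Subtype.val p.isProj.mul_self),
      Subtype.ext (show star p.val.1 = p.val.1 from congrArg Subtype.val p.isProj.star_eq)⟩

/-- Suprema in the complementary summand can be computed in `A`: the supremum of projections
orthogonal to `e` is orthogonal to `e`. -/
theorem exists_isLUB_centralComplement (hA : IsSpectralAlgebra A)
    (s : Set (ProjectionLattice (centralComplement A e he hcen)))
    (h : ∃ b, IsLUB (complementProjection e he hcen '' s) b) : ∃ b, IsLUB s b := by
  obtain ⟨b, hb⟩ := h
  have hle : ∀ p q, p ≤ q ↔ complementProjection e he hcen p ≤ complementProjection e he hcen q :=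
    fun p q => by
      change p.val * q.val = p.val ↔ _
      rw [ProjectionLattice.le_iff, Subtype.ext_iff, Subtype.ext_iff]
      rfl
  have hbe : b.val * e = 0 := by
    refine hA.isLUB_mul_eq_zero hb ?_
    rintro _ ⟨p, -, rfl⟩
    rw [← hcen]
    exact Subtype.ext p.val.2.2
  have hbC : b.val.1 ∈ centralComplement A e he hcen := by
    refine ⟨b.val.2, ?_⟩
    rw [← hcen] at hbe
    exact congrArg Subtype.val hbe
  refine ⟨.of ⟨b.val.1, hbC⟩
    ⟨Subtype.ext (show b.val.1 * b.val.1 = b.val.1 from congrArg Subtype.val b.isProj.mul_self),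
      Subtype.ext (show star b.val.1 = b.val.1 from congrArg Subtype.val b.isProj.star_eq)⟩, fun p hp => ?_, fun c hc => ?_⟩
  · rw [hle]
    exact hb.1 ⟨p, hp, rfl⟩
  · rw [hle]
    refine hb.2 ?_
    rintro _ ⟨p, hp, rfl⟩
    exact (hle _ _).1 (hc hp)

end Split

theorem finiteDimensional_of_injective_of_mem {W V : Type*} [AddCommGroup W] [Module ℂ W]
    [AddCommGroup V] [Module ℂ V] (f : W →ₗ[ℂ] V) (hf : Function.Injective f) (U : Submodule ℂ V)
    [FiniteDimensional ℂ U] (h : ∀ x, f x ∈ U) : FiniteDimensional ℂ W :=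
  FiniteDimensional.of_injective (f.codRestrict U h)
    fun _ _ hxy => hf (congrArg Subtype.val hxy)

/-- An R*-algebra whose projection lattice is upward `σ`-complete is the direct sum of a commutative
and a finite-dimensional R*-algebra. The map `f` is the inclusion of the projections of the
commutative summand; suprema that exist in `A` exist in the summand. -/
theorem exists_splitting {H : Type*} [NormedAddCommGroup H] [InnerProductSpace ℂ H]
    [CompleteSpace H] {A : NonUnitalStarSubalgebra ℂ (H →L[ℂ] H)} (hA : IsRStarAlgebra A)
    (hs : IsUpwardSigmaComplete (ProjectionLattice A)) :
    ∃ C B : NonUnitalStarSubalgebra ℂ (H →L[ℂ] H), IsRStarAlgebra C ∧ IsRStarAlgebra B ∧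
      (∀ x y : C, x * y = y * x) ∧ FiniteDimensional ℂ B ∧
      Nonempty (A ≃⋆ₐ[ℂ] (C × B)) ∧
      ∃ f : ProjectionLattice C → ProjectionLattice A,
        ∀ s : Set (ProjectionLattice C), (∃ b, IsLUB (f '' s) b) → ∃ b, IsLUB s b := by
  obtain ⟨e, he, hcen, hcomm, V, hV, hBV⟩ := hA.isSpectralAlgebra.exists_central_projection hs
  refine ⟨centralComplement A e he hcen, centralCorner A e he hcen,
    isRStarAlgebra_centralComplement e he hcen hA, isRStarAlgebra_centralCorner e he hcen hA,
    fun x y => ?_, ?_, ⟨centralSplitting e he hcen⟩, complementProjection e he hcen,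
    exists_isLUB_centralComplement e he hcen hA.isSpectralAlgebra⟩
  · have h := hcomm ⟨x.1, x.2.1⟩ ⟨y.1, y.2.1⟩ (Subtype.ext x.2.2) (Subtype.ext y.2.2)
    exact Subtype.ext (show x.1 * y.1 = y.1 * x.1 from congrArg Subtype.val h)
  · let f : centralCorner A e he hcen →ₗ[ℂ] A :=
      { toFun := fun x => ⟨x.1, x.2.1⟩
        map_add' := fun _ _ => rfl
        map_smul' := fun _ _ => rfl }
    refine finiteDimensional_of_injective_of_mem f (fun x y hxy => Subtype.ext ?_) V
      fun x => hBV _ (Subtype.ext x.2.2)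
    exact congrArg (fun a : A => a.1) hxy

/-- A summand of a direct sum may be replaced by an isomorphic one. -/
def replaceLeftSummand {A B C D : Type*} [NonUnitalRing A] [StarRing A] [Module ℂ A]
    [NonUnitalRing B] [StarRing B] [Module ℂ B] [NonUnitalRing C] [StarRing C] [Module ℂ C]
    [NonUnitalRing D] [StarRing D] [Module ℂ D] (g : A ≃⋆ₐ[ℂ] (C × B)) (f : C ≃⋆ₐ[ℂ] D) :
    A ≃⋆ₐ[ℂ] (D × B) :=
  g.trans
    { toFun := fun x => (f x.1, x.2)
      invFun := fun x => (f.symm x.1, x.2)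
      left_inv := fun _ => Prod.ext (f.symm_apply_apply _) rfl
      right_inv := fun _ => Prod.ext (f.apply_symm_apply _) rfl
      map_add' := fun _ _ => Prod.ext (map_add f _ _) rfl
      map_mul' := fun _ _ => Prod.ext (map_mul f _ _) rfl
      map_smul' := fun _ _ => Prod.ext (map_smul f _ _) rfl
      map_star' := fun _ => Prod.ext (map_star f _) rfl }

/-- The projection lattice of `R(S) ⊕ B` is that of `S` times that of `B`, and `B` is a Baer ring,
so that its projections even form a complete lattice. -/
theorem isUpwardSigmaComplete_of_starAlgEquiv {A K S : Type*} [NonUnitalRing A] [StarRing A]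
    [Module ℂ A] [GeneralizedBooleanAlgebra S] [NormedAddCommGroup K] [InnerProductSpace ℂ K]
    [CompleteSpace K] {B : NonUnitalStarSubalgebra ℂ (K →L[ℂ] K)} (hS : IsUpwardSigmaComplete S)
    (hB : IsRStarAlgebra B) [FiniteDimensional ℂ B] (f : A ≃⋆ₐ[ℂ] (commRStarAlgebra S × B)) :
    IsUpwardSigmaComplete (ProjectionLattice A) := by
  refine (isUpwardSigmaComplete_prod (hS.of_orderIso (stoneOrderIso S).symm)
    fun s _ _ => ?_).of_orderIso (projectionOrderIso f)
  exact hB.isSpectralAlgebra.exists_isLUB_of_isBaerRing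
    hB.isSpectralAlgebra.isBaerRing_of_finiteDimensional s

theorem exists_sigmaComplete_decomposition {H : Type u} [NormedAddCommGroup H]
    [InnerProductSpace ℂ H] [CompleteSpace H] {A : NonUnitalStarSubalgebra ℂ (H →L[ℂ] H)}
    (hA : IsRStarAlgebra A) (hs : IsUpwardSigmaComplete (ProjectionLattice A)) :
    ∃ (S : Type u) (_ : GeneralizedBooleanAlgebra S) (B : NonUnitalStarSubalgebra ℂ (H →L[ℂ] H)),
      IsSigmaComplete S ∧ IsRStarAlgebra B ∧ FiniteDimensional ℂ B ∧
        Nonempty (A ≃⋆ₐ[ℂ] (commRStarAlgebra S × B)) := by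
  obtain ⟨C, B, hC, hB, hcomm, hfin, ⟨g⟩, f, hf⟩ := exists_splitting hA hs
  obtain ⟨S, iS, ⟨φ⟩⟩ := exists_generalizedBooleanAlgebra hcomm
  obtain ⟨h⟩ := hC.isSpectralAlgebra.exists_commutative_representation hcomm φ
  have hCs : IsSigmaComplete (ProjectionLattice C) :=
    hC.isSpectralAlgebra.isSigmaComplete_of_upward fun s hs0 hsc =>
      hf s (hs _ (hs0.image f) (hsc.image f))
  exact ⟨S, iS, B, hCs.of_orderIso φ, hB, hfin, ⟨replaceLeftSummand g h⟩⟩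

theorem IsBaerRing.exists_complete_decomposition {H : Type u} [NormedAddCommGroup H]
    [InnerProductSpace ℂ H] [CompleteSpace H] {A : NonUnitalStarSubalgebra ℂ (H →L[ℂ] H)}
    (hBaer : IsBaerRing A) (hA : IsRStarAlgebra A) :
    ∃ (S : Type u) (_ : CompleteBooleanAlgebra S) (B : NonUnitalStarSubalgebra ℂ (H →L[ℂ] H)),
      IsRStarAlgebra B ∧ FiniteDimensional ℂ B ∧
        Nonempty (A ≃⋆ₐ[ℂ] (commRStarAlgebra S × B)) := by
  have hlub := hA.isSpectralAlgebra.exists_isLUB_of_isBaerRing hBaer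
  obtain ⟨C, B, hC, hB, hcomm, hfin, ⟨g⟩, f, hf⟩ := exists_splitting hA fun s _ _ => hlub s
  obtain ⟨S, iS, ⟨φ⟩⟩ := exists_completeBooleanAlgebra hcomm fun s => hf s (hlub _)
  obtain ⟨h⟩ := hC.isSpectralAlgebra.exists_commutative_representation hcomm φ
  exact ⟨S, iS, B, hB, hfin, ⟨replaceLeftSummand g h⟩⟩

theorem isBaerRing_of_starAlgEquiv {A K S : Type*} [NonUnitalRing A] [StarRing A]
    [Module ℂ A] [CompleteBooleanAlgebra S] [NormedAddCommGroup K] [InnerProductSpace ℂ K]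
    [CompleteSpace K] {B : NonUnitalStarSubalgebra ℂ (K →L[ℂ] K)}
    (hB : IsRStarAlgebra B) [FiniteDimensional ℂ B] (f : A ≃⋆ₐ[ℂ] (commRStarAlgebra S × B)) :
    IsBaerRing A :=
  IsBaerRing.of_starAlgEquiv_prod f (isBaerRing_commRStarAlgebra S)
    hB.isSpectralAlgebra.isBaerRing_of_finiteDimensional

theorem mainTheorem7 {H : Type u} [NormedAddCommGroup H] [InnerProductSpace ℂ H] [CompleteSpace H]
    (A : NonUnitalStarSubalgebra ℂ (H →L[ℂ] H)) (hA : IsRStarAlgebra A) :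
    List.TFAE [
      IsSigmaComplete (ProjectionLattice A),
      IsUpwardSigmaComplete (ProjectionLattice A),
      ∃ (S : Type u) (_ : GeneralizedBooleanAlgebra S)
        (K : Type u) (_ : NormedAddCommGroup K) (_ : InnerProductSpace ℂ K) (_ : CompleteSpace K)
        (B : NonUnitalStarSubalgebra ℂ (K →L[ℂ] K)),
        IsSigmaComplete S ∧ IsRStarAlgebra B ∧ FiniteDimensional ℂ B ∧
          Nonempty (A ≃⋆ₐ[ℂ] (commRStarAlgebra S × B))] ∧
    (IsBaerRing A ↔
      ∃ (S : Type u) (_ : CompleteBooleanAlgebra S)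
        (K : Type u) (_ : NormedAddCommGroup K) (_ : InnerProductSpace ℂ K) (_ : CompleteSpace K)
        (B : NonUnitalStarSubalgebra ℂ (K →L[ℂ] K)),
        IsRStarAlgebra B ∧ FiniteDimensional ℂ B ∧
          Nonempty (A ≃⋆ₐ[ℂ] (commRStarAlgebra S × B))) := by
  refine ⟨?_, fun hBaer => ?_, ?_⟩
  · tfae_have 1 → 2 := fun h => h.1
    tfae_have 2 → 1 := hA.isSpectralAlgebra.isSigmaComplete_of_upward
    tfae_have 2 → 3 := by
      intro hs
      obtain ⟨S, iS, B, h⟩ := exists_sigmaComplete_decomposition hA hs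
      exact ⟨S, iS, H, inferInstance, inferInstance, inferInstance, B, h⟩
    tfae_have 3 → 2 := by
      rintro ⟨S, _, K, _, _, _, B, hS, hB, _, ⟨f⟩⟩
      exact isUpwardSigmaComplete_of_starAlgEquiv hS.1 hB f
    tfae_finish
  · obtain ⟨S, iS, B, h⟩ := hBaer.exists_complete_decomposition hA
    exact ⟨S, iS, H, inferInstance, inferInstance, inferInstance, B, h⟩
  · rintro ⟨S, _, K, _, _, _, B, hB, _, ⟨f⟩⟩
    exact isBaerRing_of_starAlgEquiv hB f
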